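/- Let $k,m,n\ge 1$ be integers and let $f(k)$ be a real number (an arbitrary function $f$ of the alphabet size). Let $\mathcal M_{k,f(k)}$ be the set of pairs $(P,Q)$ of probability distributions on $\{1,\dots,k\}$ with $P_i\le f(k)\,Q_i$ for all $i$, and let $D(P\|Q)=\sum_{i=1}^k P_i\log\frac{P_i}{Q_i}$ (with $0\log 0=0$). From $m$ i.i.d. samples of $P$ and, independently, $n$ i.i.d. samples of $Q$, let $M_i$ and $N_i$ be the numbers of occurrences of the letter $i$ in the two samples. For a constant $c>0$ the augmented plug-in estimator is $$\hat D_c(M,N)=\sum_{i=1}^k \frac{M_i}{m}\log\frac{M_i/m}{(N_i+c)/(n+kc)},$$ and its worst-case quadratic risk is $R_c(k,m,n,f(k))=\sup_{(P,Q)\in\mathcal M_{k,f(k)}}\mathbb E\big[(\hat D_c(M,N)-D(P\|Q))^2\big]$. Write $$\rho=\Big(\frac{kf(k)}{n}+\frac km\Big)^2+\frac{\log^2 f(k)}{m}+\frac{f(k)}{n}.$$ (Upper bound) For all $0<c_0\le c_1$ and $f_0>1$ there is a constant $C>0$, depending only on $c_0,c_1,f_0$, such that $R_c(k,m,n,f(k))\le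 C\rho$ for every $c\in[c_0,c_1]$ and all $k\ge 1$, $m\ge k$, $n\ge 10kf(k)$ with $f(k)\ge f_0$. (Lower bound) There is an absolute constant $C'>0$ such that $R_c(k,m,n,f(k))\ge C'\rho$ for every $c\in[\tfrac23,\tfrac54]$ and all $k\ge 2$, $m\ge k$, $n\ge 10kf(k)$ with $f(k)\ge 10$. In particular $R_c(k,m,n,f(k))\asymp\rho$ for $c\in[\tfrac23,\tfrac54]$, $k\ge 2$, $m\ge k$, $n\ge 10kf(k)$, $f(k)\ge 10$. -/

import Mathlib

open scoped ENNReal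

noncomputable section

/-- Pairs `(P, Q)` of probability distributions on an alphabet with `k` letters whose density
ratio is bounded by `b`.  The constraint `P i / Q i ≤ b` is written `P i ≤ b * Q i`, so that it
includes the absolute continuity of `P` with respect to `Q` (`Q i = 0` forces `P i = 0`). -/
def boundedRatioPairs (k : ℕ) (b : ℝ) : Set ((Fin k → ℝ) × (Fin k → ℝ)) :=
  {PQ | PQ.1 ∈ stdSimplex ℝ (Fin k) ∧ PQ.2 ∈ stdSimplex ℝ (Fin k) ∧
    ∀ i, PQ.1 i ≤ b * PQ.2 i}

/-- The Kullback-Leibler divergence `D(P‖Q) = ∑ i, P i log (P i / Q i)` (natural logarithm) of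
two distributions on a finite alphabet, for `P` absolutely continuous with respect to `Q`;
letters with `P i = 0` contribute `0`. -/
def klDivergence {k : ℕ} (P Q : Fin k → ℝ) : ℝ :=
  ∑ i, P i * Real.log (P i / Q i)

/-- The histogram of a sample `x` of size `m`: the number of occurrences of each letter. -/
def histogram {k m : ℕ} (x : Fin m → Fin k) : Fin k → ℕ :=
  fun j => (Finset.univ.filter fun i => x i = j).card

/-- The quadratic risk `𝔼 (D̂(M, N) - D(P‖Q))²` of an estimator `D̂`, where `M` and `N` are the
histograms of two independent samples, `m` i.i.d. letters drawn from `P` and `n` i.i.d. letters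
drawn from `Q`: the expectation is the sum over all outcomes `(x, y)` of the two samples, and
`(x, y)` has probability `∏ i, P (x i) * ∏ j, Q (y j)`. -/
def quadraticRisk {k : ℕ} (D : (Fin k → ℕ) → (Fin k → ℕ) → ℝ) (m n : ℕ)
    (P Q : Fin k → ℝ) : ℝ :=
  ∑ x : Fin m → Fin k, ∑ y : Fin n → Fin k,
    ((∏ i, P (x i)) * ∏ j, Q (y j)) *
      (D (histogram x) (histogram y) - klDivergence P Q) ^ 2

/-- The worst-case quadratic risk of an estimator over all pairs with density ratio at most `b`,
as a supremum in `[0, ∞]`. -/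
def worstCaseRisk {k : ℕ} (D : (Fin k → ℕ) → (Fin k → ℕ) → ℝ) (m n : ℕ) (b : ℝ) : ℝ≥0∞ :=
  ⨆ PQ ∈ boundedRatioPairs k b, ENNReal.ofReal (quadraticRisk D m n PQ.1 PQ.2)

/-- The augmented plug-in estimator, with the empirical distribution `M i / m` for `P` and the
add-constant estimate `(N i + c) / (n + k c)` for `Q`. -/
def augmentedPlugin (c : ℝ) (k m n : ℕ) (M N : Fin k → ℕ) : ℝ :=
  ∑ i, (M i / m : ℝ) * Real.log ((M i / m : ℝ) / ((N i + c) / (n + k * c)))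

/-- The rate `(k b / n + k / m)² + log² b / m + b / n`. -/
def pluginRate (k m n : ℕ) (b : ℝ) : ℝ :=
  (k * b / n + k / m) ^ 2 + Real.log b ^ 2 / m + b / n

end

/-! Write `l = m P_i` or `l = n Q_i` for the expected count of a letter. Since `∑ (M_i - m P_i) =
0`, the error of the estimator splits exactly (`error_decomposition`) into: the convex deviations
`M_i log (M_i / l) - M_i + l`; a linear statistic of `M` with coefficients `log (P_i / Q_i)`; a
linear statistic of `N` with coefficients `P_i / Q_i`; the deterministic shifts due to `c`; the
second-order remainder of `log ((N_i + c) / l)`; and a product term in which the fluctuation of `M`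
multiplies these logarithms.

Upper bound: bound the square of each term. The nonlinear terms are sums of `k` contributions whose
second moments are `O(1)` after scaling, uniformly in `l` (`binExpect.logDeviation_sq_le`,
`binExpect.exists_sq_div_sq_le`), so Cauchy-Schwarz gives `(k/m)²` and `(kb/n)²`. The linear
statistics have variances of order `(log² b + 1) / m` and at most `b / n`. The product term costs at
most a multiple of `(k/m)(kb/n)`. The difficulty is the small counts: moments of `1 / (N + c)` are
controlled by size biasing.

Lower bound: each part of the rate is forced by its own pair. The bias is at least of order `k/m`
for `P = Q` uniform, and at most a negative multiple of `kb/n` when all letters but one have `Q_i =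
1/n`, `P_i = b/n`, as long as `k/m` is too small to compensate. The terms `log² b / m` and `b / n`
come from two-letter pairs, by testing the error against a count
(`quadraticRisk_ge_of_correlation`). The largest of the three parts of the rate is at least a third
of it, so one pair suffices for given parameters. -/

/-! ### Expectations over i.i.d. samples -/

/-- The expectation of `F x`, where `x` consists of `m` i.i.d. letters drawn from `P`. -/
noncomputable def sampleExpect {k : ℕ} (P : Fin k → ℝ) (m : ℕ) (F : (Fin m → Fin k) → ℝ) : ℝ :=
  ∑ x, (∏ i, P (x i)) * F x

namespace sampleExpect

variable {k m : ℕ} {P : Fin k → ℝ}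

theorem add (F G : (Fin m → Fin k) → ℝ) :
    sampleExpect P m (fun x => F x + G x) = sampleExpect P m F + sampleExpect P m G := by
  simp only [sampleExpect, mul_add, Finset.sum_add_distrib]

theorem sub (F G : (Fin m → Fin k) → ℝ) :
    sampleExpect P m (fun x => F x - G x) = sampleExpect P m F - sampleExpect P m G := by
  simp only [sampleExpect, mul_sub, Finset.sum_sub_distrib]

theorem const_mul (a : ℝ) (F : (Fin m → Fin k) → ℝ) :
    sampleExpect P m (fun x => a * F x) = a * sampleExpect P m F := by
  simp only [sampleExpect, Finset.mul_sum]
  exact Finset.sum_congr rfl fun _ _ => by ring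

theorem mul_const (a : ℝ) (F : (Fin m → Fin k) → ℝ) :
    sampleExpect P m (fun x => F x * a) = sampleExpect P m F * a := by
  simp only [sampleExpect, Finset.sum_mul]
  exact Finset.sum_congr rfl fun _ _ => by ring

theorem finset_sum {ι : Type*} (s : Finset ι) (F : ι → (Fin m → Fin k) → ℝ) :
    sampleExpect P m (fun x => ∑ i ∈ s, F i x) = ∑ i ∈ s, sampleExpect P m (F i) := by
  simp only [sampleExpect, Finset.mul_sum]
  exact Finset.sum_comm

theorem const (hP : ∑ i, P i = 1) (a : ℝ) : sampleExpect P m (fun _ => a) = a := by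
  have h := Fintype.sum_pow (fun i => P i) m
  rw [hP, one_pow] at h
  simp only [sampleExpect, ← Finset.sum_mul, ← h, one_mul]

/-- Samples containing a letter of probability zero carry no weight. This permits ignoring the
letters outside the support of `P`, where the logarithms take default values. -/
theorem congr_support {F G : (Fin m → Fin k) → ℝ}
    (h : ∀ x, (∀ j, P (x j) ≠ 0) → F x = G x) : sampleExpect P m F = sampleExpect P m G := by
  refine Finset.sum_congr rfl fun x _ => ?_
  by_cases hx : ∀ j, P (x j) ≠ 0
  · rw [h x hx]
  · push Not at hx
    obtain ⟨j, hj⟩ := hx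
    rw [Finset.prod_eq_zero (Finset.mem_univ j) hj, zero_mul, zero_mul]

theorem mono (hP : ∀ i, 0 ≤ P i) {F G : (Fin m → Fin k) → ℝ} (h : ∀ x, F x ≤ G x) :
    sampleExpect P m F ≤ sampleExpect P m G :=
  Finset.sum_le_sum fun x _ =>
    mul_le_mul_of_nonneg_left (h x) (Finset.prod_nonneg fun i _ => hP (x i))

theorem comm {n : ℕ} {Q : Fin k → ℝ} (F : (Fin m → Fin k) → (Fin n → Fin k) → ℝ) :
    sampleExpect P m (fun x => sampleExpect Q n (fun y => F x y)) =
      sampleExpect Q n (fun y => sampleExpect P m (fun x => F x y)) := by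
  simp only [sampleExpect, Finset.mul_sum]
  rw [Finset.sum_comm]
  exact Finset.sum_congr rfl fun _ _ => Finset.sum_congr rfl fun _ _ => by ring

theorem succ (F : (Fin (m + 1) → Fin k) → ℝ) :
    sampleExpect P (m + 1) F =
      ∑ a, P a * sampleExpect P m (fun x => F (Fin.cons a x)) := by
  simp only [sampleExpect, Finset.mul_sum]
  rw [← (Fin.consEquiv fun _ => Fin k).sum_comp, Fintype.sum_prod_type]
  refine Finset.sum_congr rfl fun a _ => Finset.sum_congr rfl fun x _ => ?_
  simp [Fin.prod_univ_succ, Fin.consEquiv, mul_assoc]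

end sampleExpect

theorem histogram_cons {k m : ℕ} (a : Fin k) (x : Fin m → Fin k) (i : Fin k) :
    histogram (Fin.cons a x : Fin (m + 1) → Fin k) i =
      histogram x i + if a = i then 1 else 0 := by
  simp only [histogram, Finset.card_filter, Fin.sum_univ_succ, Fin.cons_zero, Fin.cons_succ]
  rw [add_comm]

theorem histogram_zero {k : ℕ} (x : Fin 0 → Fin k) (i : Fin k) : histogram x i = 0 := by
  simp [histogram]

theorem sum_histogram {k m : ℕ} (x : Fin m → Fin k) : ∑ i, histogram x i = m := by
  have h := Finset.card_eq_sum_card_fiberwise (s := (Finset.univ : Finset (Fin m)))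
    (t := (Finset.univ : Finset (Fin k))) (f := x) (fun _ _ => by simp)
  simpa [histogram] using h.symm

theorem sum_histogram_real {k m : ℕ} (x : Fin m → Fin k) : ∑ i, (histogram x i : ℝ) = m := by
  exact_mod_cast sum_histogram x

theorem histogram_eq_zero {k m : ℕ} {P : Fin k → ℝ} {x : Fin m → Fin k}
    (hx : ∀ j, P (x j) ≠ 0) {i : Fin k} (hi : P i = 0) : histogram x i = 0 := by
  simp only [histogram, Finset.card_eq_zero, Finset.filter_eq_empty_iff]
  rintro j - rfl
  exact hx j hi

/-! ### Binomial expectations -/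

/-- The expectation of `F N` for a binomial variable `N` with `n` trials and success
probability `q`. -/
noncomputable def binExpect (q : ℝ) : ℕ → (ℕ → ℝ) → ℝ
  | 0, F => F 0
  | n + 1, F => q * binExpect q n (fun j => F (j + 1)) + (1 - q) * binExpect q n F

namespace binExpect

variable {q : ℝ}

theorem add (n : ℕ) (F G : ℕ → ℝ) :
    binExpect q n (fun j => F j + G j) = binExpect q n F + binExpect q n G := by
  induction n generalizing F G with
  | zero => rfl
  | succ n ih => simp only [binExpect, ih]; ring

theorem const_mul (n : ℕ) (a : ℝ) (F : ℕ → ℝ) :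
    binExpect q n (fun j => a * F j) = a * binExpect q n F := by
  induction n generalizing F with
  | zero => rfl
  | succ n ih => simp only [binExpect, ih]; ring

theorem const (n : ℕ) (a : ℝ) : binExpect q n (fun _ => a) = a := by
  induction n with
  | zero => rfl
  | succ n ih => simp only [binExpect, ih]; ring

theorem sub (n : ℕ) (F G : ℕ → ℝ) :
    binExpect q n (fun j => F j - G j) = binExpect q n F - binExpect q n G := by
  have h := add (q := q) n F (fun j => (-1) * G j)
  rw [const_mul] at h
  simpa [sub_eq_add_neg] using h

theorem mono (h0 : 0 ≤ q) (h1 : q ≤ 1) (n : ℕ) {F G : ℕ → ℝ} (h : ∀ j, F j ≤ G j) :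
    binExpect q n F ≤ binExpect q n G := by
  induction n generalizing F G with
  | zero => exact h 0
  | succ n ih =>
    have h1' : 0 ≤ 1 - q := by linarith
    exact add_le_add (mul_le_mul_of_nonneg_left (ih fun j => h (j + 1)) h0)
      (mul_le_mul_of_nonneg_left (ih h) h1')

/-- Size biasing: weighting by the number of successes fixes one successful trial and leaves the
others binomial. All bounds on inverse moments below rest on it. -/
theorem size_bias (n : ℕ) (G : ℕ → ℝ) :
    binExpect q (n + 1) (fun j => j * G j) =
      (n + 1) * q * binExpect q n (fun j => G (j + 1)) := by
  induction n generalizing G with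
  | zero => simp [binExpect]
  | succ n ih =>
    have e : (fun j : ℕ => ((j + 1 : ℕ) : ℝ) * G (j + 1)) =
        fun j => j * G (j + 1) + G (j + 1) := by
      funext j; push_cast; ring
    rw [binExpect, e, add, ih, ih, show binExpect q (n + 1) (fun j => G (j + 1)) =
      q * binExpect q n (fun j => G (j + 1 + 1)) + (1 - q) * binExpect q n (fun j => G (j + 1))
      from rfl]
    push_cast; ring

/-- A further trial moves the centred count by `1 - q` or by `-q`; expanding the power yields the
recursions for the central moments. -/
theorem central_step (n : ℕ) (p : ℕ) :
    binExpect q (n + 1) (fun j => ((j : ℝ) - (n + 1 : ℕ) * q) ^ p) =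
      q * binExpect q n (fun j => ((j - n * q) + (1 - q)) ^ p) +
        (1 - q) * binExpect q n (fun j => ((j - n * q) + (-q)) ^ p) := by
  rw [binExpect]
  congr 3 <;> funext j <;> push_cast <;> ring

theorem central_one (n : ℕ) : binExpect q n (fun j => (j : ℝ) - n * q) = 0 := by
  induction n with
  | zero => simp [binExpect]
  | succ n ih =>
    have h := central_step (q := q) n 1
    simp only [pow_one, add, const, ih] at h
    rw [h]; ring

theorem central_two (n : ℕ) :
    binExpect q n (fun j => ((j : ℝ) - n * q) ^ 2) = n * q * (1 - q) := by
  induction n with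
  | zero => simp [binExpect]
  | succ n ih =>
    have e (t : ℝ) : (fun j : ℕ => ((j - n * q) + t) ^ 2) =
        fun j : ℕ => ((j : ℝ) - n * q) ^ 2 + ((2 * t) * (j - n * q) + t ^ 2) := by
      funext j; ring
    rw [central_step, e, e]
    simp only [add, const_mul, const, ih, central_one]
    push_cast; ring

theorem central_three (n : ℕ) :
    binExpect q n (fun j => ((j : ℝ) - n * q) ^ 3) = n * q * (1 - q) * (1 - 2 * q) := by
  induction n with
  | zero => simp [binExpect]
  | succ n ih =>
    have e (t : ℝ) : (fun j : ℕ => ((j - n * q) + t) ^ 3) =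
        fun j : ℕ => ((j : ℝ) - n * q) ^ 3 + ((3 * t) * (j - n * q) ^ 2 +
          ((3 * t ^ 2) * (j - n * q) + t ^ 3)) := by
      funext j; ring
    rw [central_step, e, e]
    simp only [add, const_mul, const, ih, central_one, central_two]
    push_cast; ring

theorem central_four (n : ℕ) :
    binExpect q n (fun j => ((j : ℝ) - n * q) ^ 4) =
      n * q * (1 - q) * (1 - 3 * q * (1 - q)) + 3 * n * (n - 1) * (q * (1 - q)) ^ 2 := by
  induction n with
  | zero => simp [binExpect]
  | succ n ih =>
    have e (t : ℝ) : (fun j : ℕ => ((j - n * q) + t) ^ 4) =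
        fun j : ℕ => ((j : ℝ) - n * q) ^ 4 + ((4 * t) * (j - n * q) ^ 3 +
          ((6 * t ^ 2) * (j - n * q) ^ 2 + ((4 * t ^ 3) * (j - n * q) + t ^ 4))) := by
      funext j; ring
    rw [central_step, e, e]
    simp only [add, const_mul, const, ih, central_one, central_two, central_three]
    push_cast; ring

theorem central_four_le (h0 : 0 ≤ q) (h1 : q ≤ 1) (n : ℕ) :
    binExpect q n (fun j => ((j : ℝ) - n * q) ^ 4) ≤ 3 * (n * q) ^ 2 + n * q := by
  rw [central_four]
  have hn : (0 : ℝ) ≤ n := n.cast_nonneg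
  have hq : 0 ≤ q * (1 - q) := mul_nonneg h0 (by linarith)
  have e1 : n * q * (1 - q) * (1 - 3 * q * (1 - q)) ≤ n * q := by
    have : (1 - q) * (1 - 3 * q * (1 - q)) ≤ 1 := by nlinarith
    nlinarith [mul_nonneg hn h0]
  have e2 : 3 * (n : ℝ) * (n - 1) * (q * (1 - q)) ^ 2 ≤ 3 * (n * q) ^ 2 := by
    have h3 : (q * (1 - q)) ^ 2 ≤ q ^ 2 := by
      apply pow_le_pow_left₀ hq; nlinarith
    nlinarith [mul_nonneg hn (sq_nonneg (q * (1 - q))), mul_le_mul_of_nonneg_left h3 (sq_nonneg (n : ℝ))]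
  linarith

theorem mean (n : ℕ) : binExpect q n (fun j => (j : ℝ)) = n * q := by
  have h := central_one (q := q) n
  rw [sub, const] at h
  linarith

theorem second_moment (n : ℕ) :
    binExpect q n (fun j => (j : ℝ) ^ 2) = n * q * (1 - q) + (n * q) ^ 2 := by
  have e : (fun j : ℕ => (j : ℝ) ^ 2) =
      fun j : ℕ => ((j : ℝ) - n * q) ^ 2 + ((2 * (n * q)) * (j - n * q) + (n * q) ^ 2) := by
    funext j; ring
  rw [e]
  simp only [add, const_mul, const, central_two, central_one]
  ring

end binExpect

/-- Each single count is binomial, so statistics of one letter reduce to `binExpect`. -/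
theorem sampleExpect_histogram {k m : ℕ} {P : Fin k → ℝ} (hP : ∑ i, P i = 1) (i : Fin k)
    (F : ℕ → ℝ) :
    sampleExpect P m (fun x => F (histogram x i)) = binExpect (P i) m F := by
  induction m generalizing F with
  | zero => simp [sampleExpect, binExpect, histogram_zero]
  | succ m ih =>
    rw [sampleExpect.succ]
    have e (a : Fin k) : P a * sampleExpect P m
        (fun x => F (histogram (Fin.cons a x : Fin (m + 1) → Fin k) i)) =
        (if a = i then P a * (binExpect (P i) m (fun j => F (j + 1)) - binExpect (P i) m F) else 0)
          + P a * binExpect (P i) m F := by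
      simp only [histogram_cons]
      split_ifs with h
      · rw [ih (fun j => F (j + 1))]; ring
      · simp only [add_zero]; rw [ih F]; ring
    simp only [e, Finset.sum_add_distrib, ← Finset.sum_mul, hP]
    simp [binExpect]
    ring

theorem sampleExpect_linear {k m : ℕ} {P : Fin k → ℝ} (hP : ∑ i, P i = 1) (g : Fin k → ℝ) :
    sampleExpect P m (fun x => ∑ i, ((histogram x i : ℝ) - m * P i) * g i) = 0 := by
  rw [sampleExpect.finset_sum]
  refine Finset.sum_eq_zero fun i _ => ?_
  rw [sampleExpect.mul_const, sampleExpect_histogram hP i (fun j => (j : ℝ) - m * P i),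
    binExpect.central_one, zero_mul]

/-- The linear statistic is a sum of `m` independent copies of the centred value `g a - ∑ P_i g_i`,
so its variance is `m` times the variance of `g` under `P`. -/
theorem sampleExpect_linear_sq {k m : ℕ} {P : Fin k → ℝ} (hP : ∑ i, P i = 1) (g : Fin k → ℝ) :
    sampleExpect P m (fun x => (∑ i, ((histogram x i : ℝ) - m * P i) * g i) ^ 2) =
      m * (∑ i, P i * g i ^ 2 - (∑ i, P i * g i) ^ 2) := by
  induction m with
  | zero => simp [sampleExpect, histogram_zero]
  | succ m ih =>
    rw [sampleExpect.succ]
    set μ := ∑ i, P i * g i with hμ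
    have e (a : Fin k) (x : Fin m → Fin k) :
        ∑ i, ((histogram (Fin.cons a x : Fin (m + 1) → Fin k) i : ℝ) - (m + 1 : ℕ) * P i) * g i =
          ∑ i, ((histogram x i : ℝ) - m * P i) * g i + (g a - μ) := by
      have h1 : g a = ∑ i, (if a = i then 1 else 0) * g i := by simp
      rw [hμ]
      rw [h1]
      rw [← Finset.sum_sub_distrib, ← Finset.sum_add_distrib]
      refine Finset.sum_congr rfl fun i _ => ?_
      rw [histogram_cons]; push_cast; ring
    have e2 (a : Fin k) : sampleExpect P m (fun x =>
        (∑ i, ((histogram (Fin.cons a x : Fin (m + 1) → Fin k) i : ℝ) -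
          (m + 1 : ℕ) * P i) * g i) ^ 2) =
        m * (∑ i, P i * g i ^ 2 - μ ^ 2) + (g a - μ) ^ 2 := by
      simp only [e, add_sq]
      rw [sampleExpect.add, sampleExpect.add, ih, sampleExpect.mul_const, sampleExpect.const_mul,
        sampleExpect_linear hP, sampleExpect.const hP]
      ring
    simp only [e2]
    have e3 (a : Fin k) : P a * (m * (∑ i, P i * g i ^ 2 - μ ^ 2) + (g a - μ) ^ 2) =
        P a * (m * (∑ i, P i * g i ^ 2 - μ ^ 2) + μ ^ 2) + P a * g a ^ 2
          - (2 * μ) * (P a * g a) := by ring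
    simp only [e3, Finset.sum_sub_distrib, Finset.sum_add_distrib, ← Finset.sum_mul,
      ← Finset.mul_sum, hP, ← hμ]
    push_cast; ring

theorem sampleExpect_linear_sq_le {k m : ℕ} {P : Fin k → ℝ} (hP : ∑ i, P i = 1)
    (g : Fin k → ℝ) :
    sampleExpect P m (fun x => (∑ i, ((histogram x i : ℝ) - m * P i) * g i) ^ 2) ≤
      m * ∑ i, P i * g i ^ 2 := by
  rw [sampleExpect_linear_sq hP]
  exact mul_le_mul_of_nonneg_left (by linarith [sq_nonneg (∑ i, P i * g i)]) m.cast_nonneg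

/-! ### Elementary logarithmic inequalities -/

/-- The deviation `x log (x / l) - x + l`, which is nonnegative and vanishes at `x = l`. -/
noncomputable def logDeviation (x l : ℝ) : ℝ := x * Real.log (x / l) - x + l

theorem logDeviation_le {x l : ℝ} (hx : 0 ≤ x) (hl : 0 < l) :
    logDeviation x l ≤ (x - l) ^ 2 / l := by
  rw [logDeviation]
  have e : (x - l) ^ 2 / l = x * (x / l - 1) - x + l := by field_simp; ring
  rw [e]
  rcases hx.eq_or_lt with rfl | hx
  · simp
  · have := Real.log_le_sub_one_of_pos (div_pos hx hl)
    nlinarith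

/-- With `x = s²` and `l = t²`, the inequality `log y ≥ 1 - 1/y` at `y = s/t` bounds the deviation
below by the Hellinger term `(s - t)²`. -/
theorem logDeviation_ge {x l : ℝ} (hx : 0 ≤ x) (hl : 0 < l) :
    1 / 2 * ((x - l) ^ 2 / (x + l)) ≤ logDeviation x l := by
  rw [logDeviation]
  rcases hx.eq_or_lt with rfl | hx
  · have : (0 - l) ^ 2 / (0 + l) = l := by field_simp; ring
    rw [this]; simp; linarith
  · obtain ⟨s, hs, rfl⟩ : ∃ s, 0 < s ∧ s ^ 2 = x := ⟨√x, Real.sqrt_pos.2 hx, Real.sq_sqrt hx.le⟩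
    obtain ⟨t, ht, rfl⟩ : ∃ t, 0 < t ∧ t ^ 2 = l := ⟨√l, Real.sqrt_pos.2 hl, Real.sq_sqrt hl.le⟩
    have h1 : 2 * (1 - t / s) ≤ Real.log (s ^ 2 / t ^ 2) := by
      rw [← div_pow, Real.log_pow]
      have := Real.one_sub_inv_le_log_of_pos (div_pos hs ht)
      rw [inv_div] at this
      push_cast; linarith
    have h2 : s ^ 2 * (2 * (1 - t / s)) = 2 * s ^ 2 - 2 * s * t := by field_simp
    have h3 := mul_le_mul_of_nonneg_left h1 (sq_nonneg s)
    have h4 : (s ^ 2 - t ^ 2) ^ 2 / (s ^ 2 + t ^ 2) ≤ 2 * (s - t) ^ 2 := by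
      rw [div_le_iff₀ (by positivity)]
      nlinarith [mul_nonneg (sq_nonneg (s - t)) (sq_nonneg (s - t))]
    nlinarith

theorem logDeviation_nonneg {x l : ℝ} (hx : 0 ≤ x) (hl : 0 < l) : 0 ≤ logDeviation x l :=
  le_trans (by positivity) (logDeviation_ge hx hl)

theorem log_le_two_mul_sqrt {y : ℝ} (hy : 0 < y) : Real.log y ≤ 2 * √y := by
  have h := Real.log_le_sub_one_of_pos (Real.sqrt_pos.2 hy)
  rw [Real.log_sqrt hy.le] at h
  linarith

/-- Meant for small `l`, where squaring the chi-square bound `logDeviation_le` would give an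
expectation of order `1 / l`. Here the factor `1 / l` meets a third moment of order `l`. -/
theorem logDeviation_sq_le_cubic {l : ℝ} (hl : 0 < l) (x : ℕ) :
    logDeviation x l ^ 2 ≤ 8 / l * (x * (x : ℝ) ^ 2) + 2 * l ^ 2 := by
  have h0 := logDeviation_nonneg x.cast_nonneg hl
  rcases Nat.eq_zero_or_pos x with rfl | hx
  · simp [logDeviation]; nlinarith [sq_nonneg l]
  · have hx' : (0 : ℝ) < x := by exact_mod_cast hx
    have h1 := log_le_two_mul_sqrt (div_pos hx' hl)
    have h2 : logDeviation x l ≤ x * (2 * √(x / l)) + l := by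
      rw [logDeviation]; nlinarith
    have h3 : √((x : ℝ) / l) ^ 2 = x / l := Real.sq_sqrt (by positivity)
    calc logDeviation x l ^ 2 ≤ (x * (2 * √(x / l)) + l) ^ 2 := pow_le_pow_left₀ h0 h2 2
      _ ≤ 2 * (x * (2 * √(x / l))) ^ 2 + 2 * l ^ 2 := by
        nlinarith [sq_nonneg (x * (2 * √(x / l)) - l)]
      _ = 8 / l * (x * (x : ℝ) ^ 2) + 2 * l ^ 2 := by
        rw [mul_pow, mul_pow, h3]; ring

theorem sq_le_sinh_sq (t : ℝ) : t ^ 2 ≤ Real.sinh t ^ 2 := by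
  rcases le_total 0 t with h | h
  · exact pow_le_pow_left₀ h (Real.self_le_sinh_iff.2 h) 2
  · have := Real.sinh_le_self_iff.2 h
    nlinarith

/-- With `z / l = exp (2 t)` the two sides are `4 l t²` and `4 l sinh² t`. -/
theorem mul_log_sq_le {z l : ℝ} (hz : 0 < z) (hl : 0 < l) :
    l * Real.log (z / l) ^ 2 ≤ (z - l) ^ 2 / z := by
  obtain ⟨t, ht⟩ : ∃ t, Real.exp (2 * t) = z / l :=
    ⟨Real.log (z / l) / 2, by rw [mul_div_cancel₀ _ two_ne_zero, Real.exp_log (div_pos hz hl)]⟩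
  have hzl : z = l * (Real.exp t * Real.exp t) := by
    rw [← Real.exp_add, ← two_mul, ht]; field_simp
  rw [← ht, Real.log_exp]
  have h := sq_le_sinh_sq t
  rw [Real.sinh_eq, Real.exp_neg] at h
  have he := Real.exp_pos t
  set a := Real.exp t
  have e : (z - l) ^ 2 / z = l * (4 * ((a - a⁻¹) / 2) ^ 2) := by
    rw [hzl]; field_simp; ring
  rw [e]
  exact mul_le_mul_of_nonneg_left (by nlinarith) hl.le

theorem log_remainder_nonneg {z l : ℝ} (hz : 0 < z) (hl : 0 < l) :
    0 ≤ l * (z / l - 1 - Real.log (z / l)) :=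
  mul_nonneg hl.le (by linarith [Real.log_le_sub_one_of_pos (div_pos hz hl)])

theorem log_remainder_le {z l : ℝ} (hz : 0 < z) (hl : 0 < l) :
    l * (z / l - 1 - Real.log (z / l)) ≤ (z - l) ^ 2 / z := by
  have h := Real.one_sub_inv_le_log_of_pos (div_pos hz hl)
  rw [inv_div] at h
  have e : (z - l) ^ 2 / z = l * (z / l - 1 - (1 - l / z)) := by field_simp
  rw [e]
  exact mul_le_mul_of_nonneg_left (by linarith) hl.le

theorem sub_mul_log_sub_ge {x y : ℝ} (hx : 0 < x) (hy : 0 < y) :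
    (x - y) ^ 2 / (x + y) ≤ (x - y) * (Real.log x - Real.log y) := by
  wlog h : y ≤ x generalizing x y
  · have := this hy hx (le_of_not_ge h)
    have e : (x - y) ^ 2 / (x + y) = (y - x) ^ 2 / (y + x) := by rw [add_comm x]; ring
    rw [e]; linarith
  have h1 := Real.one_sub_inv_le_log_of_pos (div_pos hx hy)
  rw [inv_div, Real.log_div hx.ne' hy.ne'] at h1
  have h2 : (x - y) / (x + y) ≤ 1 - y / x := by
    rw [div_le_iff₀ (by positivity)]
    have : (1 - y / x) * (x + y) = (x - y) * (x + y) / x := by field_simp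
    rw [this, le_div_iff₀ hx]
    nlinarith
  rw [sq, mul_div_assoc]
  exact mul_le_mul_of_nonneg_left (h2.trans h1) (by linarith)

/-- The left side is the quadratic interpolating `log (j + c)` at `j = 0, 1, 2`. The second
differences of `log (j + c)` are smallest at `j = 0`, so the quadratic stays below. -/
theorem log_ge_quadratic {c : ℝ} (hc : 0 < c) (j : ℕ) :
    Real.log c + j * Real.log ((1 + c) / c) -
      (j : ℝ) * (j - 1) / 2 * Real.log ((1 + c) ^ 2 / (c * (c + 2))) ≤ Real.log (j + c) := by
  set γ := Real.log ((1 + c) ^ 2 / (c * (c + 2))) with hγ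
  have step (j : ℕ) : Real.log ((1 + c) / c) - j * γ ≤ Real.log (j + 1 + c) - Real.log (j + c) := by
    induction j with
    | zero => rw [Real.log_div (by positivity) hc.ne']; simp
    | succ j ih =>
      have hj : (0 : ℝ) ≤ j := j.cast_nonneg
      have h : Real.log ((j + 1 + c) ^ 2 / ((j + c) * (j + 2 + c))) ≤ γ := by
        apply Real.log_le_log (by positivity)
        rw [div_le_div_iff₀ (by positivity) (by positivity)]
        have : 0 ≤ (j : ℝ) * (j + 2 + 2 * c) := by positivity
        nlinarith
      rw [Real.log_div (by positivity) (by positivity), Real.log_pow,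
        Real.log_mul (by positivity) (by positivity)] at h
      push_cast at h ⊢
      have e : (j : ℝ) + 1 + 1 + c = j + 2 + c := by ring
      rw [e]
      linarith
  induction j with
  | zero => simp
  | succ j ih =>
    have := step j
    push_cast at ih ⊢
    nlinarith

/-! ### Binomial bounds -/

namespace binExpect

variable {q : ℝ}

/-- Size biasing of `H j / j`. Only the contribution of `j = 0` is lost, hence an inequality for
nonnegative `H`. -/
theorem div_succ_le (h0 : 0 ≤ q) (h1 : q ≤ 1) (n : ℕ) {H : ℕ → ℝ} (hH : ∀ j, 0 ≤ H j) :
    (n + 1) * q * binExpect q n (fun j => H (j + 1) / (j + 1)) ≤ binExpect q (n + 1) H := by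
  have h := size_bias (q := q) n (fun j => H j / j)
  push_cast at h
  rw [← h]
  refine mono h0 h1 _ fun j => ?_
  rcases Nat.eq_zero_or_pos j with rfl | hj
  · simpa using hH 0
  · have : (j : ℝ) ≠ 0 := by positivity
    rw [mul_div_cancel₀ _ this]

theorem inv_succ_le (h0 : 0 < q) (h1 : q ≤ 1) (n : ℕ) :
    binExpect q n (fun j => 1 / ((j : ℝ) + 1)) ≤ 1 / ((n + 1) * q) := by
  have h := div_succ_le h0.le h1 n (H := fun _ => 1) (fun _ => zero_le_one)
  rw [const] at h
  rw [le_div_iff₀ (by positivity)]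
  linarith

theorem div_succ_succ_le (h0 : 0 ≤ q) (h1 : q ≤ 1) (n : ℕ) {H : ℕ → ℝ} (hH : ∀ j, 0 ≤ H j) :
    ((n + 1) * q) * ((n + 2) * q) *
      binExpect q n (fun j => H (j + 2) / (((j : ℝ) + 1) * (j + 2))) ≤
        binExpect q (n + 2) H := by
  have e : (fun j : ℕ => H (j + 2) / (((j : ℝ) + 1) * (j + 2))) =
      fun j => H (j + 1 + 1) / ((j + 1 : ℕ) + 1) / (j + 1) := by
    funext j
    rw [div_div]; push_cast
    congr 1; ring
  have h2 := div_succ_le h0 h1 n (H := fun j => H (j + 1) / (j + 1))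
    (fun j => div_nonneg (hH _) (by positivity))
  have h3 := div_succ_le h0 h1 (n + 1) hH
  push_cast at h3
  calc _ = ((n + 2) * q) * ((n + 1) * q *
        binExpect q n (fun j => H (j + 1 + 1) / ((j + 1 : ℕ) + 1) / (j + 1))) := by rw [e]; ring
    _ ≤ ((n + 2) * q) * binExpect q (n + 1) (fun j => H (j + 1) / (j + 1)) :=
      mul_le_mul_of_nonneg_left h2 (by positivity)
    _ = (n + 1 + 1) * q * binExpect q (n + 1) (fun j => H (j + 1) / (j + 1)) := by ring
    _ ≤ _ := h3

theorem inv_succ_succ_le (h0 : 0 < q) (h1 : q ≤ 1) (n : ℕ) :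
    binExpect q n (fun j => 1 / (((j : ℝ) + 1) * (j + 2))) ≤
      1 / (((n + 1) * q) * ((n + 2) * q)) := by
  have h := div_succ_succ_le h0.le h1 n (H := fun _ => 1) (fun _ => zero_le_one)
  rw [const] at h
  rw [le_div_iff₀ (by positivity)]
  linarith

theorem second_moment_le (h0 : 0 ≤ q) (n : ℕ) :
    binExpect q n (fun j => (j : ℝ) ^ 2) ≤ n * q + (n * q) ^ 2 := by
  rw [second_moment]
  nlinarith [mul_nonneg n.cast_nonneg (mul_nonneg h0 h0)]

theorem third_moment_le (h0 : 0 ≤ q) (h1 : q ≤ 1) (n : ℕ) (hn : n * q ≤ 1) :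
    binExpect q n (fun j => (j : ℝ) * (j : ℝ) ^ 2) ≤ 6 * (n * q) := by
  rcases n with _ | n
  · simp [binExpect]
  rw [size_bias]
  push_cast at hn ⊢
  have hl : 0 ≤ n * q := by positivity
  have hl1 : n * q ≤ 1 := by nlinarith
  have h : binExpect q n (fun j => ((j : ℝ) + 1) ^ 2) ≤ 6 := by
    calc _ ≤ binExpect q n (fun j => 2 * (j : ℝ) ^ 2 + 2) :=
          mono h0 h1 n fun j => by nlinarith [sq_nonneg ((j : ℝ) - 1)]
      _ = 2 * binExpect q n (fun j => (j : ℝ) ^ 2) + 2 := by rw [add, const_mul, const]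
      _ ≤ 6 := by nlinarith [second_moment_le h0 n]
  nlinarith [mul_le_mul_of_nonneg_left h (show 0 ≤ ((n : ℝ) + 1) * q by positivity)]

/-- For mean at least `1`, the chi-square bound and the fourth central moment; for mean at most `1`,
the cubic bound and the third moment, which give `48 + 2`. -/
theorem logDeviation_sq_le (h0 : 0 ≤ q) (h1 : q ≤ 1) (n : ℕ) (hl : 0 < n * q) :
    binExpect q n (fun j => logDeviation j (n * q) ^ 2) ≤ 50 := by
  rcases le_total 1 ((n : ℝ) * q) with h | h
  · calc _ ≤ binExpect q n (fun j => 1 / (n * q) ^ 2 * ((j : ℝ) - n * q) ^ 4) := by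
          refine mono h0 h1 n fun j => ?_
          refine (pow_le_pow_left₀ (logDeviation_nonneg j.cast_nonneg hl)
            (logDeviation_le j.cast_nonneg hl) 2).trans_eq ?_
          rw [div_pow, ← pow_mul]; ring
      _ ≤ 1 / (n * q) ^ 2 * (3 * (n * q) ^ 2 + n * q) := by
          rw [const_mul]
          exact mul_le_mul_of_nonneg_left (central_four_le h0 h1 n) (by positivity)
      _ ≤ 50 := by
          rw [one_div_mul_eq_div, div_le_iff₀ (by positivity)]
          nlinarith
  · calc _ ≤ binExpect q n (fun j => 8 / (n * q) * (j * (j : ℝ) ^ 2) + 2 * (n * q) ^ 2) :=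
          mono h0 h1 n fun j => logDeviation_sq_le_cubic hl j
      _ ≤ 8 / (n * q) * (6 * (n * q)) + 2 * (n * q) ^ 2 := by
          rw [add, const_mul, const]
          have := mul_le_mul_of_nonneg_left (third_moment_le h0 h1 n h)
            (show 0 ≤ 8 / (n * q) by positivity)
          linarith
      _ = 48 + 2 * (n * q) ^ 2 := by rw [div_mul_eq_mul_div, mul_comm 6, ← mul_assoc,
            mul_right_comm, mul_div_assoc, div_self hl.ne']; ring
      _ ≤ 50 := by nlinarith

/-- The random denominator `w` is removed by the tangent `1 / w ≥ 2 a - a² w`, which leaves the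
second and third central moments. The third one accounts for the `+ 1` in the choice of `a`. -/
theorem sq_div_ge (h0 : 0 ≤ q) (h1 : q ≤ 1) (n : ℕ) (hl : 0 < n * q) {s : ℝ} (hs : 0 ≤ s) :
    n * q * (1 - q) / (2 * (n * q) + s + 1) ≤
      binExpect q n (fun j => ((j : ℝ) - n * q) ^ 2 / (j + n * q + s)) := by
  set l := (n : ℝ) * q with hl'
  set a := 1 / (2 * l + s + 1) with ha
  have ha0 : 0 < a := by positivity
  have hab : a * (2 * l + s + 1) = 1 := by rw [ha]; field_simp
  have h : binExpect q n (fun j => (2 * a - a ^ 2 * (2 * l + s)) * ((j : ℝ) - l) ^ 2 +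
      (-a ^ 2) * ((j : ℝ) - l) ^ 3) ≤
      binExpect q n (fun j => ((j : ℝ) - l) ^ 2 / (j + l + s)) := by
    refine mono h0 h1 n fun j => ?_
    have hw : 0 < (j : ℝ) + l + s := by positivity
    have h2 : 2 * a - a ^ 2 * (j + l + s) ≤ 1 / (j + l + s) := by
      rw [le_div_iff₀ hw]
      nlinarith [sq_nonneg (a * (j + l + s) - 1)]
    have h3 := mul_le_mul_of_nonneg_left h2 (sq_nonneg ((j : ℝ) - l))
    rw [div_eq_mul_one_div ((j - l) ^ 2)]
    refine le_trans (le_of_eq ?_) h3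
    ring
  rw [add, const_mul, const_mul, central_two, central_three, ← hl'] at h
  refine le_trans ?_ h
  have hV : 0 ≤ l * (1 - q) := mul_nonneg hl.le (by linarith)
  rw [div_eq_mul_one_div, ← ha]
  have e : (2 * a - a ^ 2 * (2 * l + s)) * (l * (1 - q)) + -a ^ 2 * (l * (1 - q) * (1 - 2 * q)) =
      l * (1 - q) * (2 * a - a * (a * (2 * l + s + 1)) + 2 * q * a ^ 2) := by ring
  rw [e, hab]
  exact mul_le_mul_of_nonneg_left (by nlinarith [mul_nonneg h0 (sq_nonneg a)]) hV

theorem logDeviation_ge (h0 : 0 ≤ q) (h1 : q ≤ 1) (n : ℕ) (hl : 0 < n * q) :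
    1 / 2 * (n * q * (1 - q) / (2 * (n * q) + 1)) ≤
      binExpect q n (fun j => logDeviation j (n * q)) := by
  have h := sq_div_ge h0 h1 n hl le_rfl
  simp only [add_zero] at h
  calc _ ≤ 1 / 2 * binExpect q n (fun j => ((j : ℝ) - n * q) ^ 2 / (j + n * q)) := by linarith
    _ = binExpect q n (fun j => 1 / 2 * (((j : ℝ) - n * q) ^ 2 / (j + n * q))) := by
      rw [const_mul]
    _ ≤ _ := mono h0 h1 n fun j => _root_.logDeviation_ge j.cast_nonneg hl

theorem logDeviation_le (h0 : 0 ≤ q) (h1 : q ≤ 1) (n : ℕ) (hl : 0 < n * q) :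
    binExpect q n (fun j => logDeviation j (n * q)) ≤ 1 - q := by
  calc _ ≤ binExpect q n (fun j => 1 / (n * q) * ((j : ℝ) - n * q) ^ 2) :=
        mono h0 h1 n fun j => by
          rw [one_div_mul_eq_div]; exact _root_.logDeviation_le j.cast_nonneg hl
    _ = 1 - q := by rw [const_mul, central_two, one_div_mul_eq_div, mul_div_cancel_left₀ _ hl.ne']

theorem log_le (h0 : 0 ≤ q) (h1 : q ≤ 1) (n : ℕ) {c : ℝ} (hc : 0 < c) :
    binExpect q n (fun j => Real.log (j + c)) ≤ Real.log (n * q + c) := by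
  have hμ : 0 < n * q + c := by positivity
  calc _ ≤ binExpect q n (fun j => 1 / (n * q + c) * (j - n * q) + Real.log (n * q + c)) := by
        refine mono h0 h1 n fun j => ?_
        have hj : (0 : ℝ) < j + c := by positivity
        have h := Real.log_le_sub_one_of_pos (div_pos hj hμ)
        rw [Real.log_div hj.ne' hμ.ne'] at h
        have e : 1 / (n * q + c) * (j - n * q) = (j + c) / (n * q + c) - 1 := by
          field_simp; ring
        rw [e]; linarith
    _ = _ := by rw [add, const_mul, central_one, const]; ring

theorem log_ge (h0 : 0 ≤ q) (h1 : q ≤ 1) (n : ℕ) {c l : ℝ} (hc : 0 < c) (hl : 0 < l) :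
    Real.log l + 1 - l * binExpect q n (fun j => 1 / (j + c)) ≤
      binExpect q n (fun j => Real.log (j + c)) := by
  calc _ = binExpect q n (fun j => (Real.log l + 1) + (-l) * (1 / (j + c))) := by
        rw [add, const_mul, const]; ring
    _ ≤ _ := by
        refine mono h0 h1 n fun j => ?_
        have hj : (0 : ℝ) < j + c := by positivity
        have h := Real.one_sub_inv_le_log_of_pos (div_pos hj hl)
        rw [inv_div, Real.log_div hj.ne' hl.ne'] at h
        rw [neg_mul, mul_one_div]; linarith

/-- Take expectations in `log_ge_quadratic`, using `E[j (j - 1)] = 1 - 1/n ≤ 1`. The result is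
positive once `c (c + 2) > 1`: smoothing overestimates the logarithm of a letter expected once. -/
theorem log_ge_of_mean_one {n : ℕ} (hn : 1 ≤ n) {c : ℝ} (hc : 0 < c) :
    1 / 2 * Real.log (c * (c + 2)) ≤ binExpect (1 / n) n (fun j => Real.log (j + c)) := by
  have hn' : (1 : ℝ) ≤ n := by exact_mod_cast hn
  have h0 : (0 : ℝ) ≤ 1 / n := by positivity
  have h1 : (1 : ℝ) / n ≤ 1 := by rw [div_le_one (by positivity)]; exact hn'
  have hm : (n : ℝ) * (1 / n) = 1 := by field_simp
  set γ := Real.log ((1 + c) ^ 2 / (c * (c + 2))) with hγ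
  have hγ0 : 0 ≤ γ := Real.log_nonneg (by rw [le_div_iff₀ (by positivity)]; nlinarith)
  have e : (fun j : ℕ => Real.log c + j * Real.log ((1 + c) / c) - (j : ℝ) * (j - 1) / 2 * γ) =
      fun j : ℕ => Real.log c + ((Real.log ((1 + c) / c) + γ / 2) * j + (-γ / 2) * (j : ℝ) ^ 2) := by
    funext j; ring
  have h := mono h0 h1 n (log_ge_quadratic hc)
  rw [← hγ, e, add, add, const, const_mul, const_mul, mean, second_moment, hm] at h
  refine le_trans ?_ h
  have e2 : Real.log ((1 + c) / c) = Real.log (1 + c) - Real.log c :=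
    Real.log_div (by positivity) hc.ne'
  have e3 : γ = 2 * Real.log (1 + c) - Real.log (c * (c + 2)) := by
    rw [hγ, Real.log_div (by positivity) (by positivity), Real.log_pow]; norm_num
  have h4 : 0 ≤ γ * (1 / n) := by positivity
  nlinarith

/-- For mean `l ≥ 1`, two size biasings trade the denominator `(j + c)²` for `l²` and `n` for `n +
2` trials, and the fourth moment of the shifted count is `O(l²)`. For `l ≤ 1` the ratio is at most
`j` plus a constant. -/
theorem exists_sq_div_sq_le {c₀ c₁ : ℝ} (hc₀ : 0 < c₀) (hc₁ : c₀ ≤ c₁) :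
    ∃ K : ℝ, 0 < K ∧ ∀ c ∈ Set.Icc c₀ c₁, ∀ (q : ℝ) (n : ℕ), 0 ≤ q → q ≤ 1 → 0 < n * q →
      binExpect q n (fun j => (((j : ℝ) + c - n * q) ^ 2 / (j + c)) ^ 2) ≤ K := by
  -- Chosen so that `d (j + 2) ≤ j + c` for all `j` and all `c ≥ c₀`.
  set d := min 1 (c₀ / 2) with hd
  have hd0 : 0 < d := by positivity
  refine ⟨(240 + 8 * (c₁ + 2) ^ 4) / d ^ 2 + (4 + 2 * (c₁ + 1 / c₀) ^ 2), by positivity, ?_⟩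
  rintro c ⟨hc, hc'⟩ q n h0 h1 hl
  have hcp : 0 < c := hc₀.trans_le hc
  have hA : 0 ≤ (240 + 8 * (c₁ + 2) ^ 4) / d ^ 2 := by positivity
  have hB : 0 ≤ 4 + 2 * (c₁ + 1 / c₀) ^ 2 := by positivity
  set l := (n : ℝ) * q with hldef
  rcases le_total 1 l with h | h
  · refine le_trans ?_ (le_add_of_nonneg_right hB)
    set H : ℕ → ℝ := fun j => ((j : ℝ) - 2 + c - l) ^ 4 with hH
    have hW : binExpect q n (fun j => (((j : ℝ) + c - l) ^ 2 / (j + c)) ^ 2) ≤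
        1 / d ^ 2 * binExpect q n (fun j => H (j + 2) / (((j : ℝ) + 1) * (j + 2))) := by
      rw [← const_mul]
      refine mono h0 h1 n fun j => ?_
      have hj : (0 : ℝ) ≤ j := j.cast_nonneg
      have hd1 : d ≤ 1 := min_le_left _ _
      have hd2 : d ≤ c₀ / 2 := min_le_right _ _
      have hz : d * (j + 2) ≤ j + c := by nlinarith
      have hz2 : d ^ 2 * (((j : ℝ) + 1) * (j + 2)) ≤ (j + c) ^ 2 := by
        calc d ^ 2 * (((j : ℝ) + 1) * (j + 2)) ≤ (d * (j + 2)) ^ 2 := by nlinarith [sq_nonneg d]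
          _ ≤ (j + c) ^ 2 := pow_le_pow_left₀ (by positivity) hz 2
      have e : H (j + 2) = (((j : ℝ) + c - l) ^ 2) ^ 2 := by simp only [hH]; push_cast; ring
      rw [e, div_pow, div_mul_div_comm, one_mul]
      exact div_le_div_of_nonneg_left (by positivity) (by positivity) hz2
    have hH4 : binExpect q (n + 2) H ≤ l ^ 2 * (240 + 8 * (c₁ + 2) ^ 4) := by
      calc _ ≤ binExpect q (n + 2)
            (fun j => 8 * ((j : ℝ) - (n + 2 : ℕ) * q) ^ 4 + 8 * (c₁ + 2) ^ 4) := by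
            refine mono h0 h1 _ fun j => ?_
            have e : (j : ℝ) - 2 + c - l = (j - (n + 2 : ℕ) * q) + (2 * q - 2 + c) := by
              rw [hldef]; push_cast; ring
            simp only [hH, e]
            generalize (j : ℝ) - (n + 2 : ℕ) * q = a
            have hb : (2 * q - 2 + c) ^ 4 ≤ (c₁ + 2) ^ 4 := by
              have hb' : |2 * q - 2 + c| ≤ c₁ + 2 := abs_le.2 ⟨by linarith, by linarith⟩
              calc _ = |2 * q - 2 + c| ^ 4 := (Even.pow_abs (by decide) _).symm
                _ ≤ _ := pow_le_pow_left₀ (abs_nonneg _) hb' 4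
            have := Even.add_pow_le (n := 4) (a := a) (b := 2 * q - 2 + c) (by decide)
            norm_num at this
            linarith
        _ ≤ 8 * (3 * ((n + 2 : ℕ) * q) ^ 2 + (n + 2 : ℕ) * q) + 8 * (c₁ + 2) ^ 4 := by
            rw [add, const_mul, const]
            linarith [central_four_le h0 h1 (n + 2)]
        -- As `q ≤ 1 ≤ l`, the mean `l + 2 q` is at most `3 l`, and `8 (3 · 9 + 3) = 240`.
        _ ≤ _ := by
            have e : ((n + 2 : ℕ) : ℝ) * q = l + 2 * q := by rw [hldef]; push_cast; ring
            rw [e]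
            have h3 : l + 2 * q ≤ 3 * l := by linarith
            have h4 : (l + 2 * q) ^ 2 ≤ (3 * l) ^ 2 := pow_le_pow_left₀ (by linarith) h3 2
            have h5 : (1 : ℝ) ≤ l ^ 2 := by nlinarith
            have h6 : 0 ≤ (c₁ + 2) ^ 4 := by positivity
            nlinarith
    have hS := div_succ_succ_le h0 h1 n (H := H) (fun j => by simp only [hH]; positivity)
    have hE : 0 ≤ binExpect q n (fun j => H (j + 2) / (((j : ℝ) + 1) * (j + 2))) := by
      have := mono h0 h1 n (F := fun _ => 0)
        (G := fun j => H (j + 2) / (((j : ℝ) + 1) * (j + 2)))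
        (fun j => by simp only [hH]; positivity)
      rwa [const] at this
    have hl2 : l ^ 2 ≤ ((n + 1) * q) * ((n + 2) * q) := by
      rw [hldef]; nlinarith [mul_nonneg h0 h0, mul_nonneg n.cast_nonneg (mul_nonneg h0 h0)]
    have hfin : binExpect q n (fun j => H (j + 2) / (((j : ℝ) + 1) * (j + 2))) ≤
        240 + 8 * (c₁ + 2) ^ 4 := by
      have := (mul_le_mul_of_nonneg_right hl2 hE).trans (hS.trans hH4)
      exact le_of_mul_le_mul_left this (by positivity)
    calc _ ≤ _ := hW
      _ ≤ 1 / d ^ 2 * (240 + 8 * (c₁ + 2) ^ 4) := mul_le_mul_of_nonneg_left hfin (by positivity)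
      _ = _ := by rw [one_div_mul_eq_div]
  · refine le_trans ?_ (le_add_of_nonneg_left hA)
    calc _ ≤ binExpect q n (fun j => 2 * (j : ℝ) ^ 2 + 2 * (c₁ + 1 / c₀) ^ 2) := by
          refine mono h0 h1 n fun j => ?_
          have hz : (0 : ℝ) < j + c := by positivity
          have hi : 1 / (j + c) ≤ 1 / c₀ :=
            one_div_le_one_div_of_le hc₀ (hc.trans (le_add_of_nonneg_left j.cast_nonneg))
          have hw : ((j : ℝ) + c - l) ^ 2 / (j + c) ≤ j + (c₁ + 1 / c₀) := by
            have e : ((j : ℝ) + c - l) ^ 2 / (j + c) = (j + c) - 2 * l + l ^ 2 * (1 / (j + c)) := by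
              field_simp; ring
            rw [e]
            have : l ^ 2 * (1 / (j + c)) ≤ 1 * (1 / c₀) :=
              mul_le_mul (by nlinarith) hi (by positivity) zero_le_one
            linarith
          calc _ ≤ ((j : ℝ) + (c₁ + 1 / c₀)) ^ 2 := pow_le_pow_left₀ (by positivity) hw 2
            _ ≤ _ := by nlinarith [sq_nonneg ((j : ℝ) - (c₁ + 1 / c₀))]
      _ ≤ _ := by
          rw [add, const_mul, const]
          nlinarith [second_moment_le h0 n]

end binExpect

/-! ### The error of the augmented plug-in estimator -/

theorem binExpect.zero_prob (n : ℕ) (F : ℕ → ℝ) : binExpect 0 n F = F 0 := by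
  induction n with
  | zero => rfl
  | succ n ih => simp [binExpect, ih]

theorem quadraticRisk_eq {k m n : ℕ} (D : (Fin k → ℕ) → (Fin k → ℕ) → ℝ) (P Q : Fin k → ℝ) :
    quadraticRisk D m n P Q = sampleExpect P m (fun x => sampleExpect Q n (fun y =>
      (D (histogram x) (histogram y) - klDivergence P Q) ^ 2)) := by
  simp only [quadraticRisk, sampleExpect, Finset.mul_sum]
  exact Finset.sum_congr rfl fun _ _ => Finset.sum_congr rfl fun _ _ => by ring

theorem augmentedPlugin_sub_klDivergence {k m n : ℕ} (hm : 0 < m) (hn : 0 < n) {c : ℝ}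
    (hc : 0 < c) {P Q : Fin k → ℝ} (hP : ∀ i, 0 ≤ P i) (hP1 : ∑ i, P i = 1) (hQ : ∀ i, 0 ≤ Q i)
    (hPQ : ∀ i, Q i = 0 → P i = 0) {x : Fin m → Fin k} (hx : ∀ j, P (x j) ≠ 0)
    (N : Fin k → ℕ) :
    augmentedPlugin c k m n (histogram x) N - klDivergence P Q =
      1 / m * ∑ i, logDeviation (histogram x i) (m * P i) +
        1 / m * ∑ i, ((histogram x i : ℝ) - m * P i) * Real.log (P i / Q i) +
        Real.log (1 + k * c / n) -
        ∑ i, histogram x i / m * Real.log ((N i + c) / (n * Q i)) := by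
  have hm' : (0 : ℝ) < m := by exact_mod_cast hm
  have hn' : (0 : ℝ) < n := by exact_mod_cast hn
  have hM : ∑ i, (histogram x i / m : ℝ) = 1 := by
    rw [← Finset.sum_div, sum_histogram_real, div_self hm'.ne']
  have hz : ∑ i, ((histogram x i / m : ℝ) - P i) = 0 := by
    rw [Finset.sum_sub_distrib, hM, hP1, sub_self]
  have hκ : Real.log (1 + k * c / n) = ∑ i, histogram x i / m * Real.log (1 + k * c / n) := by
    rw [← Finset.sum_mul, hM, one_mul]
  -- The terms `-M_i + m P_i` inside `logDeviation` cancel only after summation. Replacing `0` by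
  -- their vanishing sum makes the identity hold letter by letter.
  rw [← sub_eq_zero, ← hz, augmentedPlugin, klDivergence, hκ, Finset.mul_sum, Finset.mul_sum,
    ← Finset.sum_add_distrib, ← Finset.sum_add_distrib, ← Finset.sum_sub_distrib,
    ← Finset.sum_sub_distrib, ← Finset.sum_sub_distrib]
  refine Finset.sum_congr rfl fun i _ => ?_
  rcases (hP i).eq_or_lt with h | h
  · have h0 := histogram_eq_zero hx h.symm
    simp [h0, ← h, logDeviation]
  have hQi : 0 < Q i := lt_of_le_of_ne (hQ i) fun h0 => h.ne' (hPQ i h0.symm)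
  rcases Nat.eq_zero_or_pos (histogram x i) with h0 | h0
  · simp only [h0, logDeviation]
    field_simp
    simp
    ring
  have hMi : (0 : ℝ) < histogram x i := by exact_mod_cast h0
  have hN : (0 : ℝ) < N i + c := by positivity
  have hs : (0 : ℝ) < n + k * c := by positivity
  have e1 : Real.log ((histogram x i / m : ℝ) / ((N i + c) / (n + k * c))) =
      Real.log (histogram x i) - Real.log m - Real.log (N i + c) + Real.log (n + k * c) := by
    rw [Real.log_div (by positivity) (by positivity), Real.log_div hMi.ne' hm'.ne',
      Real.log_div hN.ne' hs.ne']; ring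
  have e2 : Real.log (1 + k * c / n) = Real.log (n + k * c) - Real.log n := by
    rw [← Real.log_div hs.ne' hn'.ne']; congr 1; field_simp
  have e3 : Real.log ((N i + c) / (n * Q i)) =
      Real.log (N i + c) - Real.log n - Real.log (Q i) := by
    rw [Real.log_div hN.ne' (by positivity), Real.log_mul hn'.ne' hQi.ne']; ring
  have e4 : Real.log ((histogram x i : ℝ) / (m * P i)) =
      Real.log (histogram x i) - Real.log m - Real.log (P i) := by
    rw [Real.log_div hMi.ne' (by positivity), Real.log_mul hm'.ne' h.ne']; ring
  rw [logDeviation, e1, e2, e3, e4, Real.log_div h.ne' hQi.ne']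
  field_simp
  ring

/-! ### The upper bound -/

/-- If `p ≥ q`, the ratio lies in `[1, b]`. If `p ≤ q`, the logarithm is not bounded by `log b`, but
`mul_log_sq_le` gives at most `(q - p)² / q ≤ q`. -/
theorem mul_log_div_sq_le {p q b : ℝ} (hp : 0 ≤ p) (hq : 0 ≤ q) (hpq : p ≤ b * q) :
    p * Real.log (p / q) ^ 2 ≤ p * Real.log b ^ 2 + q := by
  rcases hp.eq_or_lt with rfl | hp
  · simpa using hq
  have hq : 0 < q := lt_of_le_of_ne hq fun h => by rw [← h] at hpq; linarith
  rcases le_total q p with h | h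
  · have h1 : 0 ≤ Real.log (p / q) := Real.log_nonneg ((one_le_div hq).2 h)
    have h2 : Real.log (p / q) ≤ Real.log b :=
      Real.log_le_log (div_pos hp hq) ((div_le_iff₀ hq).2 hpq)
    have := mul_le_mul_of_nonneg_left (pow_le_pow_left₀ h1 h2 2) hp.le
    linarith
  · have h1 := mul_log_sq_le hq hp
    rw [← inv_div, Real.log_inv, neg_sq] at h1
    have h2 : (q - p) ^ 2 / q ≤ q := by
      rw [div_le_iff₀ hq]; nlinarith
    have : 0 ≤ p * Real.log b ^ 2 := by positivity
    linarith

theorem sq_sum_seven_le (a b c d e f g : ℝ) :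
    (a + b + c - d - e + f - g) ^ 2 ≤
      7 * (a ^ 2 + b ^ 2 + c ^ 2 + d ^ 2 + e ^ 2 + f ^ 2 + g ^ 2) := by
  have h := sq_sum_le_card_mul_sum_sq (s := Finset.univ) (f := ![a, b, c, -d, -e, f, -g])
  simp [Fin.sum_univ_succ] at h
  ring_nf at h ⊢
  exact h

section UpperBound

variable {k m n : ℕ} {b c : ℝ} {P Q : Fin k → ℝ}

theorem ratio_zero (h : (P, Q) ∈ boundedRatioPairs k b) {i : Fin k} (hi : Q i = 0) : P i = 0 := by
  have h1 := h.2.2 i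
  simp only [hi, mul_zero] at h1
  exact le_antisymm h1 (h.1.1 i)

theorem le_one_of_mem_stdSimplex (hP : P ∈ stdSimplex ℝ (Fin k)) (i : Fin k) : P i ≤ 1 := by
  rw [← hP.2]
  exact Finset.single_le_sum (fun j _ => hP.1 j) (Finset.mem_univ i)

/-- In the last term of `augmentedPlugin_sub_klDivergence`, split `M_i / m` into `P_i` and a
fluctuation, and expand the logarithm to first order in the `P_i` part only. -/
theorem error_decomposition (hm : 0 < m) (hn : 0 < n) (hc : 0 < c)
    (h : (P, Q) ∈ boundedRatioPairs k b) {x : Fin m → Fin k} (hx : ∀ j, P (x j) ≠ 0)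
    (N : Fin k → ℕ) :
    augmentedPlugin c k m n (histogram x) N - klDivergence P Q =
      1 / m * ∑ i, logDeviation (histogram x i) (m * P i) +
        1 / m * ∑ i, ((histogram x i : ℝ) - m * P i) * Real.log (P i / Q i) +
        Real.log (1 + k * c / n) -
        1 / n * ∑ i, ((N i : ℝ) - n * Q i) * (P i / Q i) -
        ∑ i, P i * (c / (n * Q i)) +
        ∑ i, P i * ((N i + c) / (n * Q i) - 1 - Real.log ((N i + c) / (n * Q i))) -
        1 / m * ∑ i, ((histogram x i : ℝ) - m * P i) * Real.log ((N i + c) / (n * Q i)) := by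
  have hm' : (0 : ℝ) < m := by exact_mod_cast hm
  have hn' : (0 : ℝ) < n := by exact_mod_cast hn
  rw [augmentedPlugin_sub_klDivergence hm hn hc h.1.1 h.1.2 h.2.1.1 (fun i => ratio_zero h) hx]
  have key : ∑ i, histogram x i / m * Real.log ((N i + c) / (n * Q i)) =
      1 / n * ∑ i, ((N i : ℝ) - n * Q i) * (P i / Q i) + ∑ i, P i * (c / (n * Q i)) -
        ∑ i, P i * ((N i + c) / (n * Q i) - 1 - Real.log ((N i + c) / (n * Q i))) +
        1 / m * ∑ i, ((histogram x i : ℝ) - m * P i) * Real.log ((N i + c) / (n * Q i)) := by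
    rw [Finset.mul_sum, Finset.mul_sum, ← Finset.sum_add_distrib, ← Finset.sum_sub_distrib,
      ← Finset.sum_add_distrib]
    refine Finset.sum_congr rfl fun i _ => ?_
    by_cases hi : Q i = 0
    · simp [hi, ratio_zero h hi]
    · field_simp
      ring
  rw [key]; ring

theorem expect_logDeviation_sum_sq_le (hm : 0 < m) (hP : P ∈ stdSimplex ℝ (Fin k)) :
    sampleExpect P m (fun x => (1 / m * ∑ i, logDeviation (histogram x i) (m * P i)) ^ 2) ≤
      50 * (k / m) ^ 2 := by
  have hm' : (0 : ℝ) < m := by exact_mod_cast hm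
  calc _ ≤ sampleExpect P m (fun x => (1 / m) ^ 2 *
        (k * ∑ i, logDeviation (histogram x i) (m * P i) ^ 2)) := by
        refine sampleExpect.mono hP.1 fun x => ?_
        rw [mul_pow]
        refine mul_le_mul_of_nonneg_left ?_ (by positivity)
        simpa using sq_sum_le_card_mul_sum_sq (s := Finset.univ)
          (f := fun i => logDeviation (histogram x i) (m * P i))
    _ = (1 / m) ^ 2 * (k * ∑ i, binExpect (P i) m (fun j => logDeviation j (m * P i) ^ 2)) := by
        rw [sampleExpect.const_mul, sampleExpect.const_mul, sampleExpect.finset_sum]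
        congr 2
        exact Finset.sum_congr rfl fun i _ =>
          sampleExpect_histogram hP.2 i (fun j => logDeviation j (m * P i) ^ 2)
    _ ≤ (1 / m) ^ 2 * (k * ∑ _i : Fin k, 50) := by
        gcongr with i
        rcases (hP.1 i).eq_or_lt with h | h
        · rw [← h, binExpect.zero_prob]; simp [logDeviation]
        · exact binExpect.logDeviation_sq_le h.le (le_one_of_mem_stdSimplex hP i) m (by positivity)
    _ = 50 * (k / m) ^ 2 := by simp; field_simp

theorem expect_scaled_linear_sq_le (hP : P ∈ stdSimplex ℝ (Fin k)) (g : Fin k → ℝ) :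
    sampleExpect P m (fun x => (1 / m * ∑ i, ((histogram x i : ℝ) - m * P i) * g i) ^ 2) ≤
      1 / m * ∑ i, P i * g i ^ 2 := by
  rcases Nat.eq_zero_or_pos m with rfl | hm
  · simp [sampleExpect]
  have hm' : (0 : ℝ) < m := by exact_mod_cast hm
  simp only [mul_pow]
  rw [sampleExpect.const_mul]
  calc _ ≤ (1 / m : ℝ) ^ 2 * (m * ∑ i, P i * g i ^ 2) :=
        mul_le_mul_of_nonneg_left (sampleExpect_linear_sq_le hP.2 g) (by positivity)
    _ = _ := by field_simp

theorem sum_mul_log_sq_le (h : (P, Q) ∈ boundedRatioPairs k b) :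
    ∑ i, P i * Real.log (P i / Q i) ^ 2 ≤ Real.log b ^ 2 + 1 := by
  calc _ ≤ ∑ i, (P i * Real.log b ^ 2 + Q i) :=
        Finset.sum_le_sum fun i _ => mul_log_div_sq_le (h.1.1 i) (h.2.1.1 i) (h.2.2 i)
    _ = _ := by
      have h1 : ∑ i, P i = 1 := h.1.2
      have h2 : ∑ i, Q i = 1 := h.2.1.2
      rw [Finset.sum_add_distrib, ← Finset.sum_mul, h1, h2, one_mul]

theorem sum_mul_ratio_sq_le (h : (P, Q) ∈ boundedRatioPairs k b) :
    ∑ i, Q i * (P i / Q i) ^ 2 ≤ b := by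
  have h1 : ∑ i, P i = 1 := h.1.2
  calc _ ≤ ∑ i, b * P i := by
        refine Finset.sum_le_sum fun i _ => ?_
        have hp : 0 ≤ P i := h.1.1 i
        have hle : P i ≤ b * Q i := h.2.2 i
        rcases (h.2.1.1 i : 0 ≤ Q i).eq_or_lt with hi | hi
        · simp [ratio_zero h hi.symm]
        · have e : Q i * (P i / Q i) ^ 2 = P i * P i / Q i := by field_simp
          rw [e, div_le_iff₀ hi]
          nlinarith
    _ = b := by rw [← Finset.mul_sum, h1, mul_one]

theorem sum_mul_const_le (hn : 0 < n) (hc : 0 < c) (hb : 0 ≤ b)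
    (h : (P, Q) ∈ boundedRatioPairs k b) :
    ∑ i, P i * (c / (n * Q i)) ≤ c * (k * b / n) := by
  have hn' : (0 : ℝ) < n := by exact_mod_cast hn
  calc _ ≤ ∑ _i : Fin k, c * b / n := by
        refine Finset.sum_le_sum fun i _ => ?_
        have hle : P i ≤ b * Q i := h.2.2 i
        rcases (h.2.1.1 i : 0 ≤ Q i).eq_or_lt with hi | hi
        · rw [ratio_zero h hi.symm, zero_mul]; positivity
        · rw [← mul_div_assoc, div_le_div_iff₀ (by positivity) hn']
          have := mul_le_mul_of_nonneg_right hle (show 0 ≤ c * n by positivity)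
          linarith
    _ = _ := by simp; ring

/-- Since `P_i ≤ (b / n) (n Q_i)`, `log_remainder_le` bounds each summand by `b / n` times the ratio
whose second moment is at most `K`; Cauchy-Schwarz over the letters costs a factor `k`. -/
theorem expect_remainder_sq_le (hn : 0 < n) (hc : 0 < c) (h : (P, Q) ∈ boundedRatioPairs k b)
    (hb : 0 ≤ b) {K : ℝ} (hK : ∀ (q : ℝ) (n : ℕ), 0 ≤ q → q ≤ 1 → 0 < n * q →
      binExpect q n (fun j => (((j : ℝ) + c - n * q) ^ 2 / (j + c)) ^ 2) ≤ K) (hK0 : 0 ≤ K) :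
    sampleExpect Q n (fun y => (∑ i, P i * ((histogram y i + c) / (n * Q i) - 1 -
      Real.log ((histogram y i + c) / (n * Q i)))) ^ 2) ≤ K * (k * b / n) ^ 2 := by
  have hn' : (0 : ℝ) < n := by exact_mod_cast hn
  calc _ ≤ sampleExpect Q n (fun y => k * ∑ i, (P i * ((histogram y i + c) / (n * Q i) - 1 -
        Real.log ((histogram y i + c) / (n * Q i)))) ^ 2) := by
        refine sampleExpect.mono h.2.1.1 fun y => ?_
        simpa using sq_sum_le_card_mul_sum_sq (s := Finset.univ)
          (f := fun i => P i * ((histogram y i + c) / (n * Q i) - 1 -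
            Real.log ((histogram y i + c) / (n * Q i))))
    _ = k * ∑ i, binExpect (Q i) n (fun j => (P i * ((j + c) / (n * Q i) - 1 -
        Real.log ((j + c) / (n * Q i)))) ^ 2) := by
        rw [sampleExpect.const_mul, sampleExpect.finset_sum]
        congr 1
        exact Finset.sum_congr rfl fun i _ => sampleExpect_histogram h.2.1.2 i (fun j =>
          (P i * ((j + c) / (n * Q i) - 1 - Real.log ((j + c) / (n * Q i)))) ^ 2)
    _ ≤ k * ∑ _i : Fin k, (b / n) ^ 2 * K := by
        gcongr with i
        have hp : 0 ≤ P i := h.1.1 i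
        have hle : P i ≤ b * Q i := h.2.2 i
        have hq1 : Q i ≤ 1 := le_one_of_mem_stdSimplex h.2.1 i
        rcases (h.2.1.1 i : 0 ≤ Q i).eq_or_lt with hi | hi
        · simp only [ratio_zero h hi.symm, zero_mul]
          rw [zero_pow two_ne_zero, binExpect.const]
          positivity
        · have hl : 0 < n * Q i := by positivity
          refine le_trans ?_ (mul_le_mul_of_nonneg_left (hK (Q i) n hi.le hq1 hl) (by positivity))
          rw [← binExpect.const_mul]
          refine binExpect.mono hi.le hq1 n fun j => ?_
          have hz : (0 : ℝ) < j + c := by positivity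
          have h1 := log_remainder_nonneg hz hl
          have h2 := log_remainder_le hz hl
          have h3 : 0 ≤ (j + c) / (n * Q i) - 1 - Real.log ((j + c) / (n * Q i)) :=
            nonneg_of_mul_nonneg_right h1 hl
          rw [← mul_pow]
          refine pow_le_pow_left₀ (mul_nonneg hp h3) ?_ 2
          refine (mul_le_mul_of_nonneg_right hle h3).trans ?_
          refine le_trans (le_of_eq ?_) (mul_le_mul_of_nonneg_left h2 (show 0 ≤ b / n by positivity))
          generalize (j + c) / (n * Q i) - 1 - Real.log ((j + c) / (n * Q i)) = r
          field_simp
    _ = _ := by simp; ring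

theorem expect_sum_mul_log_sq_le (hn : 0 < n) (hc : 0 < c) (h : (P, Q) ∈ boundedRatioPairs k b)
    (hb : 0 ≤ b) {K : ℝ} (hK : ∀ (q : ℝ) (n : ℕ), 0 ≤ q → q ≤ 1 → 0 < n * q →
      binExpect q n (fun j => (((j : ℝ) + c - n * q) ^ 2 / (j + c)) ^ 2) ≤ K) (hK0 : 0 ≤ K) :
    sampleExpect Q n (fun y => ∑ i, P i * Real.log ((histogram y i + c) / (n * Q i)) ^ 2) ≤
      (1 + K) * (k * b / n) := by
  have hn' : (0 : ℝ) < n := by exact_mod_cast hn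
  calc _ = ∑ i, binExpect (Q i) n (fun j => P i * Real.log ((j + c) / (n * Q i)) ^ 2) := by
        rw [sampleExpect.finset_sum]
        exact Finset.sum_congr rfl fun i _ => sampleExpect_histogram h.2.1.2 i (fun j =>
          P i * Real.log ((j + c) / (n * Q i)) ^ 2)
    _ ≤ ∑ _i : Fin k, b / n * (1 + K) := by
        refine Finset.sum_le_sum fun i _ => ?_
        have hle : P i ≤ b * Q i := h.2.2 i
        have hq1 : Q i ≤ 1 := le_one_of_mem_stdSimplex h.2.1 i
        rcases (h.2.1.1 i : 0 ≤ Q i).eq_or_lt with hi | hi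
        · simp only [ratio_zero h hi.symm, zero_mul]
          rw [binExpect.const]
          positivity
        · have hl : 0 < n * Q i := by positivity
          calc _ ≤ binExpect (Q i) n (fun j => b / n *
                (1 + (((j : ℝ) + c - n * Q i) ^ 2 / (j + c)) ^ 2)) := by
                refine binExpect.mono hi.le hq1 n fun j => ?_
                have hz : (0 : ℝ) < j + c := by positivity
                have h2 := mul_log_sq_le hz hl
                have h3 : ((j : ℝ) + c - n * Q i) ^ 2 / (j + c) ≤
                    1 + (((j : ℝ) + c - n * Q i) ^ 2 / (j + c)) ^ 2 := by
                  nlinarith [sq_nonneg (((j : ℝ) + c - n * Q i) ^ 2 / (j + c) - 1)]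
                refine (mul_le_mul_of_nonneg_right hle (sq_nonneg _)).trans ?_
                refine le_trans (le_of_eq ?_) (mul_le_mul_of_nonneg_left (h2.trans h3)
                  (show 0 ≤ b / n by positivity))
                generalize Real.log ((j + c) / (n * Q i)) ^ 2 = r
                field_simp
            _ ≤ b / n * (1 + K) := by
                rw [binExpect.const_mul, binExpect.add, binExpect.const]
                gcongr
                exact hK (Q i) n hi.le hq1 hl
    _ = _ := by simp; ring

theorem quadraticRisk_augmentedPlugin_le (hm : 0 < m) (hn : 0 < n) (hc : 0 < c) (hb : 1 ≤ b)
    (h : (P, Q) ∈ boundedRatioPairs k b) {K : ℝ}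
    (hK : ∀ (q : ℝ) (n : ℕ), 0 ≤ q → q ≤ 1 → 0 < n * q →
      binExpect q n (fun j => (((j : ℝ) + c - n * q) ^ 2 / (j + c)) ^ 2) ≤ K) (hK0 : 0 ≤ K) :
    quadraticRisk (augmentedPlugin c k m n) m n P Q ≤
      7 * (50 * (k / m) ^ 2 + 1 / m * (Real.log b ^ 2 + 1) + (k * c / n) ^ 2 + 1 / n * b +
        (c * (k * b / n)) ^ 2 + K * (k * b / n) ^ 2 + 1 / m * ((1 + K) * (k * b / n))) := by
  have hm' : (0 : ℝ) < m := by exact_mod_cast hm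
  have hn' : (0 : ℝ) < n := by exact_mod_cast hn
  have hP1 : ∑ i, P i = 1 := h.1.2
  have hQ1 : ∑ i, Q i = 1 := h.2.1.2
  rw [quadraticRisk_eq]
  refine (sampleExpect.congr_support fun x hx => congrArg (sampleExpect Q n) (funext fun y =>
    congrArg (· ^ 2) (error_decomposition hm hn hc h hx (histogram y)))).trans_le ?_
  refine (sampleExpect.mono h.1.1 fun x => sampleExpect.mono h.2.1.1 fun y =>
    sq_sum_seven_le _ _ _ _ _ _ _).trans ?_
  simp only [sampleExpect.const_mul, sampleExpect.add, sampleExpect.const hP1,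
    sampleExpect.const hQ1]
  have hκ0 : 0 ≤ Real.log (1 + k * c / n) :=
    Real.log_nonneg (le_add_of_nonneg_right (by positivity))
  have hκ : Real.log (1 + k * c / n) ≤ k * c / n := by
    have := Real.log_le_sub_one_of_pos (show 0 < 1 + k * c / n by positivity)
    linarith
  have h5 : 0 ≤ ∑ i, P i * (c / (n * Q i)) := Finset.sum_nonneg fun i _ =>
    mul_nonneg (h.1.1 i) (div_nonneg hc.le (mul_nonneg hn'.le (h.2.1.1 i)))
  have h7 : sampleExpect P m (fun x => sampleExpect Q n (fun y => (1 / m * ∑ i,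
      ((histogram x i : ℝ) - m * P i) *
        Real.log ((histogram y i + c) / (n * Q i))) ^ 2)) ≤ 1 / m * ((1 + K) * (k * b / n)) := by
    -- For fixed `y` this is a linear statistic of `x`, so its conditional second moment is
    -- available.
    rw [sampleExpect.comm]
    refine (sampleExpect.mono h.2.1.1 fun y => expect_scaled_linear_sq_le h.1 _).trans ?_
    rw [sampleExpect.const_mul]
    exact mul_le_mul_of_nonneg_left
      (expect_sum_mul_log_sq_le hn hc h (by linarith) hK hK0) (by positivity)
  refine mul_le_mul_of_nonneg_left ?_ (by norm_num)
  refine add_le_add (add_le_add (add_le_add (add_le_add (add_le_add (add_le_add ?_ ?_) ?_) ?_) ?_)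
    ?_) h7
  · exact expect_logDeviation_sum_sq_le hm h.1
  · exact (expect_scaled_linear_sq_le h.1 _).trans
      (mul_le_mul_of_nonneg_left (sum_mul_log_sq_le h) (by positivity))
  · exact pow_le_pow_left₀ hκ0 hκ 2
  · exact (expect_scaled_linear_sq_le h.2.1 _).trans
      (mul_le_mul_of_nonneg_left (sum_mul_ratio_sq_le h) (by positivity))
  · exact pow_le_pow_left₀ h5 (sum_mul_const_le hn hc (by linarith) h) 2
  · exact expect_remainder_sq_le hn hc h (by linarith) hK hK0

end UpperBound

theorem worstCaseRisk_augmentedPlugin_le {c₀ c₁ f₀ : ℝ} (hc₀ : 0 < c₀) (hc₁ : c₀ ≤ c₁)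
    (hf₀ : 1 < f₀) :
    ∃ C : ℝ, 0 < C ∧ ∀ c ∈ Set.Icc c₀ c₁, ∀ (b : ℝ) (k m n : ℕ),
      1 ≤ k → k ≤ m → 10 * (k : ℝ) * b ≤ n → f₀ ≤ b →
        worstCaseRisk (augmentedPlugin c k m n) m n b ≤
          ENNReal.ofReal (C * pluginRate k m n b) := by
  obtain ⟨K, hK0, hK⟩ := binExpect.exists_sq_div_sq_le hc₀ hc₁
  have hlog : 0 < Real.log f₀ := Real.log_pos hf₀
  refine ⟨7 * (53 + 1 / Real.log f₀ ^ 2 + 2 * c₁ ^ 2 + 2 * K), by positivity, ?_⟩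
  rintro c hc b k m n hk hkm hn hb
  have hcp : 0 < c := hc₀.trans_le hc.1
  have hb1 : 1 ≤ b := by linarith
  have hm : 0 < m := by omega
  have hk' : (1 : ℝ) ≤ k := by exact_mod_cast hk
  have hm' : (0 : ℝ) < m := by exact_mod_cast hm
  have hn' : (0 : ℝ) < n := by nlinarith
  have hn0 : 0 < n := by exact_mod_cast hn'
  refine iSup₂_le fun PQ hPQ => ENNReal.ofReal_le_ofReal ?_
  refine (quadraticRisk_augmentedPlugin_le hm hn0 hcp hb1 hPQ (hK c hc) hK0.le).trans ?_
  rw [mul_assoc]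
  refine mul_le_mul_of_nonneg_left ?_ (by norm_num)
  rw [pluginRate]
  have hA : 0 ≤ k * b / n := by positivity
  have hκ : k * c / n ≤ c₁ * (k * b / n) := by
    rw [← mul_div_assoc]
    refine div_le_div_of_nonneg_right ?_ hn'.le
    have h1 := mul_le_mul_of_nonneg_left hc.2 (by linarith : (0 : ℝ) ≤ k)
    have h2 := mul_le_mul_of_nonneg_left hb1 (show 0 ≤ k * c₁ by nlinarith)
    linarith
  have hκ2 := pow_le_pow_left₀ (by positivity) hκ 2
  have h5 : (c * (k * b / n)) ^ 2 ≤ (c₁ * (k * b / n)) ^ 2 :=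
    pow_le_pow_left₀ (by positivity) (mul_le_mul_of_nonneg_right hc.2 hA) 2
  have h1m : 1 / (m : ℝ) ≤ k / m := div_le_div_of_nonneg_right hk' hm'.le
  -- The extra `1 / m` in the variance is absorbed by `log² b / m`; this is where `b` must stay away
  -- from `1`.
  have hL : 1 ≤ 1 / Real.log f₀ ^ 2 * Real.log b ^ 2 := by
    rw [one_div_mul_eq_div, one_le_div (by positivity)]
    exact pow_le_pow_left₀ hlog.le (Real.log_le_log (by linarith) hb) 2
  have h2 : 1 / (m : ℝ) * (Real.log b ^ 2 + 1) ≤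
      (1 + 1 / Real.log f₀ ^ 2) * (Real.log b ^ 2 / m) := by
    have := mul_le_mul_of_nonneg_left hL (show 0 ≤ 1 / (m : ℝ) by positivity)
    have e : (1 + 1 / Real.log f₀ ^ 2) * (Real.log b ^ 2 / m) = 1 / (m : ℝ) * Real.log b ^ 2 +
      1 / (m : ℝ) * (1 / Real.log f₀ ^ 2 * Real.log b ^ 2) := by ring
    rw [e]; linarith
  have h7 : 1 / (m : ℝ) * ((1 + K) * (k * b / n)) ≤ (1 + K) * ((k / m) * (k * b / n)) := by
    have := mul_le_mul_of_nonneg_right h1m (show 0 ≤ (1 + K) * (k * b / n) by positivity)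
    linarith
  rw [mul_pow] at hκ2 h5
  have hL0 : 0 ≤ Real.log b ^ 2 / m := by positivity
  have hF0 : 0 ≤ b / n := by positivity
  have hB : 0 ≤ (k : ℝ) / m := by positivity
  have hF : 1 / (n : ℝ) * b = b / n := by ring
  rw [hF]
  set I := 1 / Real.log f₀ ^ 2
  have hI : 0 ≤ I := by positivity
  generalize k * b / (n : ℝ) = A at *
  generalize (k : ℝ) / m = B at *
  generalize Real.log b ^ 2 / (m : ℝ) = L at *
  generalize b / (n : ℝ) = F at *
  have hA2 : A ^ 2 ≤ (A + B) ^ 2 := pow_le_pow_left₀ hA (by linarith) 2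
  have hB2 : B ^ 2 ≤ (A + B) ^ 2 := pow_le_pow_left₀ hB (by linarith) 2
  have hAB : B * A ≤ (A + B) ^ 2 := by nlinarith [sq_nonneg A, sq_nonneg B, mul_nonneg hB hA]
  have hc2 : 0 ≤ c₁ ^ 2 := sq_nonneg _
  have g1 := mul_le_mul_of_nonneg_left hA2 hc2
  have g2 := mul_le_mul_of_nonneg_left hA2 hK0.le
  have g3 := mul_le_mul_of_nonneg_left hAB (show 0 ≤ 1 + K by linarith)
  have g4 := mul_nonneg hI (sq_nonneg (A + B))
  have g5 := mul_nonneg hc2 hL0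
  have g6 := mul_nonneg hK0.le hL0
  have g7 := mul_nonneg hI hF0
  have g8 := mul_nonneg hc2 hF0
  have g9 := mul_nonneg hK0.le hF0
  linarith

/-! ### The lower bound -/

theorem binExpect_log_div {q : ℝ} (n : ℕ) {c l : ℝ} (hc : 0 < c) (hl : 0 < l) :
    binExpect q n (fun j => Real.log ((j + c) / l)) =
      binExpect q n (fun j => Real.log (j + c)) - Real.log l := by
  have e : (fun j : ℕ => Real.log ((j + c) / l)) = fun j : ℕ => Real.log (j + c) - Real.log l := by
    funext j
    rw [Real.log_div (by positivity) hl.ne']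
  rw [e, binExpect.sub, binExpect.const]

section LowerBound

variable {k m n : ℕ} {b c : ℝ} {P Q : Fin k → ℝ}

/-- Expand `(error - t Z)² ≥ 0`. Optimising `t` would give Cauchy-Schwarz; a free `t` avoids a
division and allows suboptimal choices. -/
theorem quadraticRisk_ge_of_correlation (D : (Fin k → ℕ) → (Fin k → ℕ) → ℝ)
    (hP : ∀ i, 0 ≤ P i) (hQ : ∀ i, 0 ≤ Q i)
    (Z : (Fin m → Fin k) → (Fin n → Fin k) → ℝ) (t : ℝ) :
    2 * t * sampleExpect P m (fun x => sampleExpect Q n (fun y =>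
        (D (histogram x) (histogram y) - klDivergence P Q) * Z x y)) -
      t ^ 2 * sampleExpect P m (fun x => sampleExpect Q n (fun y => Z x y ^ 2)) ≤
      quadraticRisk D m n P Q := by
  rw [quadraticRisk_eq]
  simp only [← sampleExpect.const_mul, ← sampleExpect.sub]
  refine sampleExpect.mono hP fun x => sampleExpect.mono hQ fun y => ?_
  nlinarith [sq_nonneg (D (histogram x) (histogram y) - klDivergence P Q - t * Z x y)]

theorem sq_bias_le_quadraticRisk (D : (Fin k → ℕ) → (Fin k → ℕ) → ℝ)
    (hP : P ∈ stdSimplex ℝ (Fin k)) (hQ : Q ∈ stdSimplex ℝ (Fin k)) :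
    sampleExpect P m (fun x => sampleExpect Q n (fun y =>
        D (histogram x) (histogram y) - klDivergence P Q)) ^ 2 ≤ quadraticRisk D m n P Q := by
  have h := quadraticRisk_ge_of_correlation (m := m) (n := n) D hP.1 hQ.1 (fun _ _ => 1)
    (sampleExpect P m (fun x => sampleExpect Q n (fun y =>
        D (histogram x) (histogram y) - klDivergence P Q)))
  simp only [mul_one, one_pow, sampleExpect.const hP.2, sampleExpect.const hQ.2] at h
  linarith

/-! ### Pairs for which the bias is large -/

theorem bias_augmentedPlugin (hm : 0 < m) (hn : 0 < n) (hc : 0 < c)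
    (h : (P, Q) ∈ boundedRatioPairs k b) :
    sampleExpect P m (fun x => sampleExpect Q n (fun y =>
        augmentedPlugin c k m n (histogram x) (histogram y) - klDivergence P Q)) =
      1 / m * ∑ i, binExpect (P i) m (fun j => logDeviation j (m * P i)) +
        Real.log (1 + k * c / n) -
        ∑ i, P i * binExpect (Q i) n (fun j => Real.log ((j + c) / (n * Q i))) := by
  have hm' : (0 : ℝ) < m := by exact_mod_cast hm
  have hP1 : ∑ i, P i = 1 := h.1.2
  have hQ1 : ∑ i, Q i = 1 := h.2.1.2
  refine (sampleExpect.congr_support fun x hx => congrArg (sampleExpect Q n) (funext fun y =>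
    augmentedPlugin_sub_klDivergence hm hn hc h.1.1 h.1.2 h.2.1.1 (fun i => ratio_zero h) hx
      (histogram y))).trans ?_
  simp only [sampleExpect.add, sampleExpect.sub, sampleExpect.const_mul, sampleExpect.const hP1,
    sampleExpect.const hQ1, sampleExpect_linear hP1, sampleExpect.finset_sum,
    sampleExpect.mul_const, sampleExpect.const_mul]
  have e1 (i : Fin k) : sampleExpect P m (fun x => logDeviation (histogram x i) (m * P i)) =
      binExpect (P i) m (fun j => logDeviation j (m * P i)) :=
    sampleExpect_histogram hP1 i (fun j => logDeviation j (m * P i))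
  have e2 (i : Fin k) : sampleExpect Q n
      (fun y => Real.log ((histogram y i + c) / (n * Q i))) =
      binExpect (Q i) n (fun j => Real.log ((j + c) / (n * Q i))) :=
    sampleExpect_histogram hQ1 i (fun j => Real.log ((j + c) / (n * Q i)))
  have e3 (i : Fin k) : sampleExpect P m (fun x => (histogram x i / m : ℝ)) = P i := by
    rw [sampleExpect_histogram hP1 i (fun j => (j / m : ℝ))]
    have e : (fun j : ℕ => (j / m : ℝ)) = fun j : ℕ => (1 / m : ℝ) * j := by funext j; ring
    rw [e, binExpect.const_mul, binExpect.mean]; field_simp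
  simp only [e1, e2, e3]
  ring

/-- Take `P = Q` uniform. By Jensen the smoothed `Q` part of the bias is nonnegative, and each
letter contributes at least `1/12` to the `P` part because its mean `m / k` is at least `1`. -/
theorem exists_risk_ge_alphabet_div_sample (hk : 2 ≤ k) (hkm : k ≤ m) (hn : 0 < n) (hc : 0 < c)
    (hb : 1 ≤ b) :
    ∃ PQ ∈ boundedRatioPairs k b, 1 / 144 * (k / m) ^ 2 ≤
      quadraticRisk (augmentedPlugin c k m n) m n PQ.1 PQ.2 := by
  have hk' : (2 : ℝ) ≤ k := by exact_mod_cast hk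
  have hkm' : (k : ℝ) ≤ m := by exact_mod_cast hkm
  have hm' : (0 : ℝ) < m := by linarith
  have hn' : (0 : ℝ) < n := by exact_mod_cast hn
  have hm : 0 < m := by omega
  have hU : (fun _ : Fin k => (1 / k : ℝ)) ∈ stdSimplex ℝ (Fin k) :=
    ⟨fun _ => by positivity, by simp; field_simp⟩
  have hmem : ((fun _ : Fin k => (1 / k : ℝ)), (fun _ : Fin k => (1 / k : ℝ))) ∈
      boundedRatioPairs k b :=
    ⟨hU, hU, fun _ => le_mul_of_one_le_left (by positivity) hb⟩
  refine ⟨_, hmem, ?_⟩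
  refine le_trans ?_ (sq_bias_le_quadraticRisk _ hmem.1 hmem.2.1)
  have e : 1 / 144 * (k / m : ℝ) ^ 2 = (1 / m * (k * (1 / 12))) ^ 2 := by ring
  rw [e, bias_augmentedPlugin hm hn hc hmem]
  refine pow_le_pow_left₀ (by positivity) ?_ 2
  have hq0 : (0 : ℝ) ≤ 1 / k := by positivity
  have hq : (1 : ℝ) / k ≤ 1 / 2 := one_div_le_one_div_of_le (by norm_num) hk'
  have hl : 1 ≤ (m : ℝ) * (1 / k) := by rw [mul_one_div, one_le_div (by positivity)]; exact hkm'
  have h1 : 1 / 12 ≤ binExpect (1 / k) m (fun j => logDeviation j (m * (1 / k))) := by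
    refine le_trans ?_ (binExpect.logDeviation_ge hq0 (by linarith) m (by linarith))
    rw [mul_div_assoc', le_div_iff₀ (by linarith)]
    nlinarith
  have h2 : binExpect (1 / k) n (fun j => Real.log ((j + c) / (n * (1 / k)))) ≤
      Real.log (1 + k * c / n) := by
    rw [binExpect_log_div n hc (by positivity)]
    have h3 := binExpect.log_le hq0 (by linarith : (1 : ℝ) / k ≤ 1) n hc
    have e2 : Real.log (1 + k * c / n) = Real.log (n * (1 / k) + c) - Real.log (n * (1 / k)) := by
      rw [← Real.log_div (by positivity) (by positivity)]
      congr 1; field_simp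
    linarith
  have h4 : (1 : ℝ) / m * (k * (1 / 12)) ≤
      1 / m * (k * binExpect (1 / k) m (fun j => logDeviation j (m * (1 / k)))) := by gcongr
  simp only [Finset.sum_const, Finset.card_univ, Fintype.card_fin, nsmul_eq_mul]
  rw [← mul_assoc (k : ℝ) (1 / k), mul_one_div_cancel (by linarith), one_mul]
  linarith

theorem sum_ite_eq_add (i₀ : Fin k) (a d : ℝ) :
    ∑ i, (if i = i₀ then a else d) = a + (k - 1) * d := by
  have e (i : Fin k) : (if i = i₀ then a else d) = (if i = i₀ then a - d else 0) + d := by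
    split_ifs <;> ring
  simp only [e, Finset.sum_add_distrib, Finset.sum_ite_eq', Finset.mem_univ, if_true,
    Finset.sum_const, Finset.card_univ, Fintype.card_fin, nsmul_eq_mul]
  ring

/-- Here `16/9` is the value of `c (c + 2)` at `c = 2/3`. In units of `kb/n`, `c / 10` pays for the
normalisation `kc/n`, and `0.071 = 0.051 + 0.01 + 0.01` for the heavy letter, for `k/m` and for the
bias that remains. -/
theorem log_mul_add_two_ge {c : ℝ} (hc : 2 / 3 ≤ c) (hc' : c ≤ 5 / 4) :
    c / 10 + 71 / 1000 ≤ 1 / 4 * Real.log (c * (c + 2)) := by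
  have h1 : (0.568 : ℝ) ≤ Real.log (16 / 9) := by
    have e : (16 / 9 : ℝ) = 2 * (8 / 9) := by norm_num
    rw [e, Real.log_mul (by norm_num) (by norm_num)]
    have := Real.log_two_gt_d9
    have := Real.one_sub_inv_le_log_of_pos (show (0 : ℝ) < 8 / 9 by norm_num)
    norm_num at *
    linarith
  have h2 := Real.one_sub_inv_le_log_of_pos (show 0 < c * (c + 2) / (16 / 9) by positivity)
  rw [Real.log_div (by positivity) (by norm_num), inv_div] at h2
  have h3 : (16 / 9) / (c * (c + 2)) ≤ 4 * (0.321 - c / 10) := by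
    rw [div_le_iff₀ (by positivity)]
    nlinarith [mul_nonneg (sub_nonneg.2 hc) (sub_nonneg.2 hc'),
      mul_nonneg (mul_nonneg (sub_nonneg.2 hc) (sub_nonneg.2 hc')) (by linarith : 0 ≤ c)]
  linarith

theorem binExpect_log_div_mean_ge {q : ℝ} (hq : 0.99 ≤ q) (hq1 : q ≤ 1) (hn : 0 < n)
    (hc : 2 / 3 ≤ c) :
    -(1.02 / n) ≤ binExpect q n (fun j => Real.log ((j + c) / (n * q))) := by
  have hn' : (0 : ℝ) < n := by exact_mod_cast hn
  have hq0 : 0 < q := by linarith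
  have hl : 0 < n * q := by positivity
  rw [binExpect_log_div n (by linarith) hl]
  have h1 := binExpect.log_ge hq0.le hq1 n (c := c) (by linarith) hl
  -- The comparison of `1 / (j + c)` with the size-biasable terms is sharp at `j = 0`, where it
  -- reads `c ≥ 2/3`.
  have h2 : binExpect q n (fun j => 1 / (j + c)) ≤
      1 / ((n + 1) * q) + 1 / (((n + 1) * q) * ((n + 2) * q)) := by
    refine le_trans ?_ (add_le_add (binExpect.inv_succ_le hq0 hq1 n)
      (binExpect.inv_succ_succ_le hq0 hq1 n))
    rw [← binExpect.add]
    refine binExpect.mono hq0.le hq1 n fun j => ?_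
    have hj : (0 : ℝ) ≤ j := j.cast_nonneg
    have e : 1 / ((j : ℝ) + 1) + 1 / (((j : ℝ) + 1) * (j + 2)) =
        (j + 3) / (((j : ℝ) + 1) * (j + 2)) := by field_simp; ring
    rw [e, div_le_div_iff₀ (by positivity) (by positivity)]
    nlinarith
  have h3 : n * q * (1 / ((n + 1) * q) + 1 / (((n + 1) * q) * ((n + 2) * q))) ≤ 1 + 1.02 / n := by
    have e : (n * q * (1 / ((n + 1) * q) + 1 / (((n + 1) * q) * ((n + 2) * q))) : ℝ) =
        n / (n + 1) * (1 + 1 / ((n + 2) * q)) := by field_simp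
    have h4 : (1 : ℝ) / ((n + 2) * q) ≤ 1.02 / n := by
      rw [div_le_div_iff₀ (by positivity) hn']
      nlinarith
    have h5 : (n : ℝ) / (n + 1) ≤ 1 := by rw [div_le_one (by positivity)]; linarith
    rw [e]
    calc _ ≤ 1 * (1 + 1 / (((n : ℝ) + 2) * q)) := by gcongr
      _ ≤ _ := by linarith
  have := mul_le_mul_of_nonneg_left h2 hl.le
  linarith

/-- Each light letter is expected once in the `Q` sample and has `P_i = b / n`, so overestimating
its logarithm pushes the estimate down by order `b / n`. One heavy letter takes the remaining mass
and contributes only `O(1/n)`. -/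
theorem exists_risk_ge_ratio_alphabet_div_sample (hk : 2 ≤ k) (hkm : k ≤ m)
    (hn : 10 * (k : ℝ) * b ≤ n) (hb : 10 ≤ b) (hc : 2 / 3 ≤ c) (hc' : c ≤ 5 / 4)
    (hsmall : (k / m : ℝ) ≤ 1 / 100 * (k * b / n)) :
    ∃ PQ ∈ boundedRatioPairs k b, 1 / 10000 * (k * b / n) ^ 2 ≤
      quadraticRisk (augmentedPlugin c k m n) m n PQ.1 PQ.2 := by
  have hk' : (2 : ℝ) ≤ k := by exact_mod_cast hk
  have hn' : (0 : ℝ) < n := by nlinarith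
  have hn0 : 0 < n := by exact_mod_cast hn'
  have hm : 0 < m := by omega
  have hm' : (0 : ℝ) < m := by exact_mod_cast hm
  have hcp : 0 < c := by linarith
  let i₀ : Fin k := ⟨0, by omega⟩
  have hkb : (k - 1) * b / n ≤ 1 / 10 := by rw [div_le_iff₀ hn']; nlinarith
  have hkb0 : 0 ≤ (k - 1) * b / n := div_nonneg (mul_nonneg (by linarith) (by linarith)) hn'.le
  have hk1 : ((k : ℝ) - 1) / n ≤ 0.01 := by rw [div_le_iff₀ hn']; nlinarith
  have hk10 : 0 ≤ ((k : ℝ) - 1) / n := div_nonneg (by linarith) hn'.le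
  set p₀ := 1 - (k - 1) * b / n with hp₀
  set q₀ := 1 - ((k : ℝ) - 1) / n with hq₀
  have hp₀0 : 0 ≤ p₀ := by linarith
  have hq₀0 : 0.99 ≤ q₀ := by linarith
  set P : Fin k → ℝ := fun i => if i = i₀ then p₀ else b / n with hPdef
  set Q : Fin k → ℝ := fun i => if i = i₀ then q₀ else 1 / n with hQdef
  have hP : P ∈ stdSimplex ℝ (Fin k) := by
    refine ⟨fun i => ?_, ?_⟩
    · simp only [hPdef]; split_ifs
      · exact hp₀0
      · positivity
    · rw [hPdef, sum_ite_eq_add, hp₀]; ring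
  have hQ : Q ∈ stdSimplex ℝ (Fin k) := by
    refine ⟨fun i => ?_, ?_⟩
    · simp only [hQdef]; split_ifs
      · linarith
      · positivity
    · rw [hQdef, sum_ite_eq_add, hq₀]; ring
  have hmem : (P, Q) ∈ boundedRatioPairs k b := by
    refine ⟨hP, hQ, fun i => ?_⟩
    simp only [hPdef, hQdef]
    split_ifs
    · have e : b * q₀ = b - (k - 1) * b / n := by rw [hq₀]; ring
      rw [e, hp₀]; linarith
    · rw [mul_one_div]
  refine ⟨_, hmem, ?_⟩
  refine le_trans ?_ (sq_bias_le_quadraticRisk _ hP hQ)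
  rw [bias_augmentedPlugin hm hn0 hcp hmem]
  have h1 : 1 / m * ∑ i, binExpect (P i) m (fun j => logDeviation j (m * P i)) ≤ k / m := by
    have : ∑ i, binExpect (P i) m (fun j => logDeviation j (m * P i)) ≤ ∑ _i : Fin k, 1 := by
      refine Finset.sum_le_sum fun i _ => ?_
      rcases (hP.1 i).eq_or_lt with h | h
      · rw [← h, binExpect.zero_prob]; simp [logDeviation]
      · have := binExpect.logDeviation_le h.le (le_one_of_mem_stdSimplex hP i) m (by positivity)
        linarith
    simp only [Finset.sum_const, Finset.card_univ, Fintype.card_fin, nsmul_eq_mul, mul_one] at this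
    rw [one_div_mul_eq_div]
    gcongr
  have h2 : Real.log (1 + k * c / n) ≤ k * c / n := by
    have := Real.log_le_sub_one_of_pos (show 0 < 1 + k * c / n by positivity)
    linarith
  have h3 : ∑ i, P i * binExpect (Q i) n (fun j => Real.log ((j + c) / (n * Q i))) =
      p₀ * binExpect q₀ n (fun j => Real.log ((j + c) / (n * q₀))) +
        (k - 1) * (b / n * binExpect (1 / n) n (fun j => Real.log (j + c))) := by
    rw [← sum_ite_eq_add i₀]
    refine Finset.sum_congr rfl fun i _ => ?_
    simp only [hPdef, hQdef]
    split_ifs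
    · rfl
    · rw [mul_one_div_cancel hn'.ne']; simp only [div_one]
  have h4 := binExpect_log_div_mean_ge hq₀0 (by linarith) hn0 hc
  have h4' : -(1.02 / n) ≤ p₀ * binExpect q₀ n (fun j => Real.log ((j + c) / (n * q₀))) := by
    have h5 := mul_le_mul_of_nonneg_left h4 hp₀0
    have h6 : p₀ * (1.02 / n) ≤ 1 * (1.02 / n) := by gcongr; linarith
    linarith
  have h5 := binExpect.log_ge_of_mean_one hn0 hcp
  have hlog := log_mul_add_two_ge hc hc'
  have h6 : (k * b / n) * (c / 10 + 71 / 1000) ≤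
      (k - 1) * (b / n * binExpect (1 / n) n (fun j => Real.log (j + c))) := by
    have e : (k - 1) * (b / n * binExpect (1 / n) n (fun j => Real.log (j + c))) =
        ((k - 1) * b / n) * binExpect (1 / n) n (fun j => Real.log (j + c)) := by ring
    rw [e]
    have h7 : 1 / 2 * (k * b / n) ≤ (k - 1) * b / n := by
      rw [mul_div_assoc']
      exact div_le_div_of_nonneg_right (by nlinarith) hn'.le
    calc _ ≤ (1 / 2 * (k * b / n)) * (1 / 2 * Real.log (c * (c + 2))) := by
          have := mul_le_mul_of_nonneg_left hlog (show 0 ≤ k * b / n by positivity)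
          linarith
      _ ≤ _ := mul_le_mul h7 h5 (by linarith) hkb0
  have h8 : k * c / n ≤ (k * b / n) * (c / 10) := by
    rw [div_mul_eq_mul_div]
    refine div_le_div_of_nonneg_right ?_ hn'.le
    nlinarith [mul_nonneg (show (0 : ℝ) ≤ k by positivity) hcp.le]
  have h9 : 1.02 / n ≤ (k * b / n) * 0.051 := by
    rw [div_mul_eq_mul_div]
    gcongr
    nlinarith
  rw [h3]
  have e : 1 / 10000 * (k * b / n) ^ 2 = (1 / 100 * (k * b / n)) ^ 2 := by ring
  -- The bias is negative, so its opposite is bounded from below.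
  rw [e, ← neg_sq (_ - _)]
  refine pow_le_pow_left₀ (by positivity) ?_ 2
  linarith

/-! ### Two-letter pairs for which the fluctuations are large -/

/-- The weights `a` and `d` on the letters `i₀` and `i₁`, and `0` elsewhere. -/
noncomputable def twoPoint (i₀ i₁ : Fin k) (a d : ℝ) : Fin k → ℝ :=
  fun i => if i = i₀ then a else if i = i₁ then d else 0

theorem twoPoint_mem_stdSimplex {i₀ i₁ : Fin k} (hi : i₀ ≠ i₁) {a d : ℝ} (ha : 0 ≤ a)
    (hd : 0 ≤ d) (had : a + d = 1) : twoPoint i₀ i₁ a d ∈ stdSimplex ℝ (Fin k) := by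
  refine ⟨fun i => ?_, ?_⟩
  · simp only [twoPoint]; split_ifs <;> first | assumption | rfl
  · rw [Fintype.sum_eq_add i₀ i₁ hi fun i h => by simp [twoPoint, h.1, h.2]]
    simpa [twoPoint, hi.symm] using had

theorem twoPoint_mem_boundedRatioPairs {i₀ i₁ : Fin k} (hi : i₀ ≠ i₁) {a d a' d' : ℝ}
    (ha : 0 ≤ a) (hd : 0 ≤ d) (had : a + d = 1) (ha' : 0 ≤ a') (hd' : 0 ≤ d')
    (had' : a' + d' = 1) (h0 : a ≤ b * a') (h1 : d ≤ b * d') :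
    (twoPoint i₀ i₁ a d, twoPoint i₀ i₁ a' d') ∈ boundedRatioPairs k b := by
  refine ⟨twoPoint_mem_stdSimplex hi ha hd had, twoPoint_mem_stdSimplex hi ha' hd' had',
    fun i => ?_⟩
  simp only [twoPoint]
  split_ifs
  · exact h0
  · exact h1
  · simp

theorem augmentedPlugin_eq (hm : 0 < m) (hn : 0 < n) (hc : 0 < c) {M : Fin k → ℕ}
    (hM : ∑ i, M i = m) (N : Fin k → ℕ) :
    augmentedPlugin c k m n M N =
      ∑ i, (M i / m * Real.log (M i / m) - M i / m * Real.log (N i + c) : ℝ) +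
        Real.log (n + k * c) := by
  have hm' : (0 : ℝ) < m := by exact_mod_cast hm
  have hn' : (0 : ℝ) < n := by exact_mod_cast hn
  have h1 : ∑ i, (M i / m : ℝ) = 1 := by
    rw [← Finset.sum_div, ← Nat.cast_sum, hM, div_self hm'.ne']
  have h2 : Real.log (n + k * c) = ∑ i, (M i / m : ℝ) * Real.log (n + k * c) := by
    rw [← Finset.sum_mul, h1, one_mul]
  rw [h2, ← Finset.sum_add_distrib, augmentedPlugin]
  refine Finset.sum_congr rfl fun i _ => ?_
  rcases Nat.eq_zero_or_pos (M i) with h0 | h0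
  · simp [h0]
  · have hMi : (0 : ℝ) < M i := by exact_mod_cast h0
    rw [Real.log_div (by positivity) (by positivity), Real.log_div (x := (N i + c : ℝ))
      (by positivity) (by positivity)]
    ring

/-- The ratio of the two means is of order `b`. Jensen bounds the lower mean from above, and the
inverse moment costs at most `1/2 ≤ (log b) / 2` on the other side. -/
theorem binExpect_log_gap (hk : 2 ≤ k) (hn : 10 * (k : ℝ) * b ≤ n) (hb : 10 ≤ b)
    (hc : 2 / 3 ≤ c) (hc' : c ≤ 5 / 4) :
    1 / 2 * Real.log b ≤ binExpect (1 - 1 / (2 * b)) n (fun j => Real.log (j + c)) -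
      binExpect (1 / (2 * b)) n (fun j => Real.log (j + c)) := by
  have hk' : (2 : ℝ) ≤ k := by exact_mod_cast hk
  have hb0 : 0 < b := by linarith
  have hn1 : 20 * b ≤ n := by nlinarith
  have hn' : (0 : ℝ) < n := by linarith
  have hcp : 0 < c := by linarith
  set r := 1 / (2 * b) with hr
  have hr0 : 0 < r := by positivity
  have hr1 : r ≤ 1 / 20 := one_div_le_one_div_of_le (by norm_num) (by linarith)
  have hrb : r * b = 1 / 2 := by rw [hr]; field_simp
  have hnr : 10 ≤ n * r := by nlinarith
  have h0 := binExpect.log_le hr0.le (by linarith) n hcp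
  have hl : 0 < (n : ℝ) * (1 - r) := mul_pos hn' (by linarith)
  have h1 := binExpect.log_ge (q := 1 - r) (by linarith) (by linarith) n hcp hl
  have h2 : binExpect (1 - r) n (fun j => 1 / (j + c)) ≤ 3 / 2 * (1 / ((n + 1) * (1 - r))) := by
    refine le_trans ?_ (mul_le_mul_of_nonneg_left
      (binExpect.inv_succ_le (q := 1 - r) (by linarith) (by linarith) n) (by norm_num))
    rw [← binExpect.const_mul]
    refine binExpect.mono (by linarith) (by linarith) n fun j => ?_
    have hj : (0 : ℝ) ≤ j := j.cast_nonneg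
    rw [mul_one_div, div_le_div_iff₀ (by positivity) (by positivity)]
    linarith
  have h3 : (n : ℝ) * (1 - r) * (3 / 2 * (1 / ((n + 1) * (1 - r)))) ≤ 3 / 2 := by
    have hd : 0 < ((n : ℝ) + 1) * (1 - r) := mul_pos (by linarith) (by linarith)
    have e : (n : ℝ) * (1 - r) * (3 / 2 * (1 / ((n + 1) * (1 - r)))) =
      3 / 2 * (n * (1 - r)) / ((n + 1) * (1 - r)) := by ring
    rw [e, div_le_iff₀ hd]
    nlinarith
  have h4 := mul_le_mul_of_nonneg_left h2 hl.le
  have h5 : Real.log b + Real.log (n * r + c) ≤ Real.log (n * (1 - r)) := by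
    rw [← Real.log_mul (by positivity) (by positivity)]
    apply Real.log_le_log (by positivity)
    nlinarith
  have h6 : 1 ≤ Real.log b := by
    rw [Real.le_log_iff_exp_le hb0]
    linarith [Real.exp_one_lt_d9]
  linarith

/-- With `P` uniform on two letters and `Q = (1/(2b), 1 - 1/(2b))`, moving one observation of `P`
between the letters changes the estimate by about `(log b) / m`. -/
theorem exists_risk_ge_log_sq_div_sample (hk : 2 ≤ k) (hm : 0 < m)
    (hn : 10 * (k : ℝ) * b ≤ n) (hb : 10 ≤ b) (hc : 2 / 3 ≤ c) (hc' : c ≤ 5 / 4) :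
    ∃ PQ ∈ boundedRatioPairs k b, 1 / 16 * (Real.log b ^ 2 / m) ≤
      quadraticRisk (augmentedPlugin c k m n) m n PQ.1 PQ.2 := by
  have hk' : (2 : ℝ) ≤ k := by exact_mod_cast hk
  have hm' : (0 : ℝ) < m := by exact_mod_cast hm
  have hb0 : 0 < b := by linarith
  have hn' : (0 : ℝ) < n := by nlinarith
  have hn0 : 0 < n := by exact_mod_cast hn'
  have hcp : 0 < c := by linarith
  let i₀ : Fin k := ⟨0, by omega⟩
  let i₁ : Fin k := ⟨1, by omega⟩
  have hi : i₀ ≠ i₁ := by simp [i₀, i₁]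
  have hgap := binExpect_log_gap (c := c) hk hn hb hc hc'
  set r := 1 / (2 * b) with hr
  have hr0 : 0 < r := by positivity
  have hr1 : r ≤ 1 / 20 := one_div_le_one_div_of_le (by norm_num) (by linarith)
  have hrb : b * r = 1 / 2 := by rw [hr]; field_simp
  have hmem := twoPoint_mem_boundedRatioPairs (b := b) hi (a := 1 / 2) (d := 1 / 2) (a' := r)
    (d' := 1 - r) (by norm_num) (by norm_num) (by norm_num) hr0.le (by linarith) (by ring)
    hrb.ge (by nlinarith)
  refine ⟨_, hmem, ?_⟩
  set P := twoPoint i₀ i₁ (1 / 2 : ℝ) (1 / 2) with hPdef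
  set Q := twoPoint i₀ i₁ r (1 - r) with hQdef
  have hP0 : P i₀ = 1 / 2 := by simp [hPdef, twoPoint]
  have hP1 : P i₁ = 1 / 2 := by simp [hPdef, twoPoint]
  have hQ0 : Q i₀ = r := by simp [hQdef, twoPoint]
  have hQ1 : Q i₁ = 1 - r := by simp [hQdef, twoPoint, hi.symm]
  have hPs : ∑ i, P i = 1 := hmem.1.2
  have hQs : ∑ i, Q i = 1 := hmem.2.1.2
  set e₀ := binExpect r n (fun j => Real.log (j + c)) with he₀
  set e₁ := binExpect (1 - r) n (fun j => Real.log (j + c)) with he₁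
  set κ := Real.log (n + k * c) - klDivergence P Q with hκ
  have hout {x : Fin m → Fin k} (hx : ∀ j, P (x j) ≠ 0) (i : Fin k) (h : i ≠ i₀ ∧ i ≠ i₁) :
      histogram x i = 0 := histogram_eq_zero hx (by simp [hPdef, twoPoint, h.1, h.2])
  have htot {x : Fin m → Fin k} (hx : ∀ j, P (x j) ≠ 0) :
      (histogram x i₁ : ℝ) = m - histogram x i₀ := by
    have h := sum_histogram_real x
    rw [Fintype.sum_eq_add i₀ i₁ hi fun i h => by rw [hout hx i h, Nat.cast_zero]] at h
    linarith
  -- On the support this is `M_{i₀} - M_{i₁}`. It is antisymmetric in the letters, so the entropy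
  -- terms `g` cancel in expectation and only the gap `e₁ - e₀` survives.
  let Z : (Fin m → Fin k) → (Fin n → Fin k) → ℝ := fun x _ => 2 * (histogram x i₀ - m * (1 / 2))
  let g : ℕ → ℝ := fun j => (j / m : ℝ) * Real.log (j / m)
  have hyexp (i : Fin k) : sampleExpect Q n (fun y => Real.log (histogram y i + c)) =
      binExpect (Q i) n (fun j => Real.log (j + c)) :=
    sampleExpect_histogram hQs i (fun j => Real.log (j + c))
  have hinner (x : Fin m → Fin k) (hx : ∀ j, P (x j) ≠ 0) : sampleExpect Q n (fun y =>
      (augmentedPlugin c k m n (histogram x) (histogram y) - klDivergence P Q) * Z x y) =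
      (2 * (histogram x i₀ - m * (1 / 2)) * g (histogram x i₀) +
        2 / m * (e₁ - e₀) * (histogram x i₀ - m * (1 / 2)) ^ 2 +
        2 * (κ - e₀ / 2 - e₁ / 2) * (histogram x i₀ - m * (1 / 2))) -
        2 * (histogram x i₁ - m * (1 / 2)) * g (histogram x i₁) := by
    have hD (y : Fin n → Fin k) :
        (augmentedPlugin c k m n (histogram x) (histogram y) - klDivergence P Q) * Z x y =
        2 * (histogram x i₀ - m * (1 / 2)) * (g (histogram x i₀) + g (histogram x i₁) + κ) -
        2 * (histogram x i₀ - m * (1 / 2)) * (histogram x i₀ / m) *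
          Real.log (histogram y i₀ + c) -
        2 * (histogram x i₀ - m * (1 / 2)) * (histogram x i₁ / m) *
          Real.log (histogram y i₁ + c) := by
      rw [augmentedPlugin_eq hm hn0 hcp (sum_histogram x),
        Fintype.sum_eq_add i₀ i₁ hi fun i h => by simp [hout hx i h], hκ]
      simp only [Z, g]
      ring
    simp only [hD]
    rw [sampleExpect.sub, sampleExpect.sub, sampleExpect.const hQs, sampleExpect.const_mul,
      sampleExpect.const_mul, hyexp, hyexp, hQ0, hQ1, htot hx]
    field_simp
    ring
  have hcorr : sampleExpect P m (fun x => sampleExpect Q n (fun y =>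
      (augmentedPlugin c k m n (histogram x) (histogram y) - klDivergence P Q) * Z x y)) =
      1 / 2 * (e₁ - e₀) := by
    rw [sampleExpect.congr_support hinner, sampleExpect.sub, sampleExpect_histogram hPs i₀
      (fun j => 2 * (j - m * (1 / 2)) * g j + 2 / m * (e₁ - e₀) * (j - m * (1 / 2)) ^ 2 +
        2 * (κ - e₀ / 2 - e₁ / 2) * (j - m * (1 / 2))),
      sampleExpect_histogram hPs i₁ (fun j => 2 * (j - m * (1 / 2)) * g j), hP0, hP1,
      binExpect.add, binExpect.add, binExpect.const_mul, binExpect.const_mul,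
      binExpect.central_one, binExpect.central_two]
    field_simp
    ring
  have hvar : sampleExpect P m (fun x => sampleExpect Q n (fun y => Z x y ^ 2)) = m := by
    simp only [Z, sampleExpect.const hQs, mul_pow]
    rw [sampleExpect.const_mul, sampleExpect_histogram hPs i₀
      (fun j => ((j : ℝ) - m * (1 / 2)) ^ 2), hP0, binExpect.central_two]
    ring
  -- The optimal multiplier: the correlation `(e₁ - e₀) / 2` divided by the second moment `m`.
  have h := quadraticRisk_ge_of_correlation (augmentedPlugin c k m n) hmem.1.1 hmem.2.1.1 Z
    ((e₁ - e₀) / (2 * m))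
  rw [hcorr, hvar] at h
  refine le_trans ?_ h
  have h1 : 0 ≤ Real.log b := Real.log_nonneg (by linarith)
  have h2 : (1 / 2 * Real.log b) ^ 2 ≤ (e₁ - e₀) ^ 2 :=
    pow_le_pow_left₀ (by positivity) hgap 2
  have e : 2 * ((e₁ - e₀) / (2 * m)) * (1 / 2 * (e₁ - e₀)) - ((e₁ - e₀) / (2 * m)) ^ 2 * m =
      1 / 4 * ((e₁ - e₀) ^ 2 / m) := by field_simp; ring
  rw [e]
  have h3 := div_le_div_of_nonneg_right h2 hm'.le
  have e2 : (1 / 2 * Real.log b) ^ 2 / m = 1 / 4 * (Real.log b ^ 2 / m) := by ring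
  linarith

/-- With `P` a point mass on a letter of `Q`-probability `1 / b`, the estimator is a constant minus
`log (N_{i₀} + c)`, which fluctuates by about `l^(-1/2)` for `l = n / b`. -/
theorem exists_risk_ge_ratio_div_sample (hk : 2 ≤ k) (hm : 0 < m)
    (hn : 10 * (k : ℝ) * b ≤ n) (hb : 10 ≤ b) (hc : 0 < c) (hc' : c ≤ 5 / 4) :
    ∃ PQ ∈ boundedRatioPairs k b, 4 / 25 * (b / n) ≤
      quadraticRisk (augmentedPlugin c k m n) m n PQ.1 PQ.2 := by
  have hk' : (2 : ℝ) ≤ k := by exact_mod_cast hk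
  have hm' : (0 : ℝ) < m := by exact_mod_cast hm
  have hb0 : 0 < b := by linarith
  have hn1 : 20 * b ≤ n := by nlinarith
  have hn' : (0 : ℝ) < n := by linarith
  have hn0 : 0 < n := by exact_mod_cast hn'
  let i₀ : Fin k := ⟨0, by omega⟩
  let i₁ : Fin k := ⟨1, by omega⟩
  have hi : i₀ ≠ i₁ := by simp [i₀, i₁]
  set r := 1 / b with hr
  have hr0 : 0 < r := by positivity
  have hr1 : r ≤ 1 / 10 := one_div_le_one_div_of_le (by norm_num) hb
  have hrb : b * r = 1 := by rw [hr]; field_simp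
  have hmem := twoPoint_mem_boundedRatioPairs (b := b) hi (a := 1) (d := 0) (a' := r)
    (d' := 1 - r) (by norm_num) le_rfl (by norm_num) hr0.le (by linarith) (by ring)
    hrb.ge (by nlinarith)
  refine ⟨_, hmem, ?_⟩
  set P := twoPoint i₀ i₁ (1 : ℝ) 0 with hPdef
  set Q := twoPoint i₀ i₁ r (1 - r) with hQdef
  have hQ0 : Q i₀ = r := by simp [hQdef, twoPoint]
  have hPs : ∑ i, P i = 1 := hmem.1.2
  have hQs : ∑ i, Q i = 1 := hmem.2.1.2
  set l := (n : ℝ) * r with hl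
  have hl20 : 20 ≤ l := by rw [hl, hr, mul_one_div, le_div_iff₀ hb0]; exact hn1
  have hout {x : Fin m → Fin k} (hx : ∀ j, P (x j) ≠ 0) (i : Fin k) (h : i ≠ i₀) :
      histogram x i = 0 := histogram_eq_zero hx (by simp [hPdef, twoPoint, h])
  have htot {x : Fin m → Fin k} (hx : ∀ j, P (x j) ≠ 0) : (histogram x i₀ : ℝ) = m := by
    have h := sum_histogram_real x
    rwa [Fintype.sum_eq_single i₀ fun i h => by rw [hout hx i h, Nat.cast_zero]] at h
  let Z : (Fin m → Fin k) → (Fin n → Fin k) → ℝ := fun _ y => histogram y i₀ - l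
  set κ := Real.log (n + k * c) - klDivergence P Q - Real.log (l + c) with hκ
  set C := binExpect r n (fun j => (j - l) * (Real.log (j + c) - Real.log (l + c))) with hC
  have hcorr : sampleExpect P m (fun x => sampleExpect Q n (fun y =>
      (augmentedPlugin c k m n (histogram x) (histogram y) - klDivergence P Q) * Z x y)) = -C := by
    have hinner (x : Fin m → Fin k) (hx : ∀ j, P (x j) ≠ 0) : sampleExpect Q n (fun y =>
        (augmentedPlugin c k m n (histogram x) (histogram y) - klDivergence P Q) * Z x y) =
        -C := by
      have hD (y : Fin n → Fin k) :
          (augmentedPlugin c k m n (histogram x) (histogram y) - klDivergence P Q) * Z x y =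
          κ * (histogram y i₀ - l) - (histogram y i₀ - l) *
            (Real.log (histogram y i₀ + c) - Real.log (l + c)) := by
        rw [augmentedPlugin_eq hm hn0 hc (sum_histogram x),
          Fintype.sum_eq_single i₀ fun i h => by simp [hout hx i h], htot hx, div_self hm'.ne', hκ]
        simp only [Z, Real.log_one]
        ring
      simp only [hD]
      rw [sampleExpect_histogram hQs i₀ (fun j => κ * (j - l) - (j - l) *
        (Real.log (j + c) - Real.log (l + c))), hQ0, binExpect.sub, binExpect.const_mul,
        binExpect.central_one, ← hC]
      ring
    rw [sampleExpect.congr_support hinner, sampleExpect.const hPs]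
  have hvar : sampleExpect P m (fun x => sampleExpect Q n (fun y => Z x y ^ 2)) =
      l * (1 - r) := by
    simp only [Z, sampleExpect.const hPs]
    rw [sampleExpect_histogram hQs i₀ (fun j => ((j : ℝ) - l) ^ 2), hQ0, binExpect.central_two]
  have hCge : 2 / 5 ≤ C := by
    have h1 : binExpect r n (fun j => ((j : ℝ) - n * r) ^ 2 / (j + n * r + 2 * c)) ≤ C := by
      refine binExpect.mono hr0.le (by linarith) n fun j => ?_
      have h := sub_mul_log_sub_ge (x := j + c) (y := l + c) (by positivity) (by positivity)
      have e1 : (j : ℝ) + c - (l + c) = j - l := by ring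
      have e2 : (j : ℝ) + c + (l + c) = j + l + 2 * c := by ring
      rwa [e1, e2] at h
    refine le_trans ?_ ((binExpect.sq_div_ge hr0.le (by linarith) n (by linarith)
      (show 0 ≤ 2 * c by linarith)).trans h1)
    rw [← hl, le_div_iff₀ (by linarith)]
    nlinarith
  -- Nearly optimal: the correlation is at most `-2/5`, and the second moment of `Z` is at most `l`.
  have h := quadraticRisk_ge_of_correlation (augmentedPlugin c k m n) hmem.1.1 hmem.2.1.1 Z
    (-(2 / 5 / l))
  rw [hcorr, hvar] at h
  refine le_trans ?_ h
  have hbn : b / n = 1 / l := by rw [hl, hr]; field_simp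
  have hl0 : 0 < l := by linarith
  have h1 : 2 / 5 / l * (2 / 5) ≤ 2 / 5 / l * C := by gcongr
  have h2 : (2 / 5 / l) ^ 2 * (l * (1 - r)) ≤ 2 / 5 / l * (2 / 5) := by
    have e : (2 / 5 / l) ^ 2 * (l * (1 - r)) = 2 / 5 / l * (2 / 5) * (1 - r) := by field_simp
    rw [e]
    exact mul_le_of_le_one_right (by positivity) (by linarith)
  have e : 4 / 25 * (b / n) = 2 / 5 / l * (2 / 5) := by rw [hbn]; ring
  rw [e, neg_sq]
  linarith

end LowerBound

theorem le_worstCaseRisk {k m n : ℕ} {b : ℝ} {D : (Fin k → ℕ) → (Fin k → ℕ) → ℝ} {r : ℝ}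
    (h : ∃ PQ ∈ boundedRatioPairs k b, r ≤ quadraticRisk D m n PQ.1 PQ.2) :
    ENNReal.ofReal r ≤ worstCaseRisk D m n b := by
  obtain ⟨PQ, hPQ, hr⟩ := h
  exact (ENNReal.ofReal_le_ofReal hr).trans
    (le_iSup₂ (f := fun PQ (_ : PQ ∈ boundedRatioPairs k b) =>
      ENNReal.ofReal (quadraticRisk D m n PQ.1 PQ.2)) PQ hPQ)

theorem le_worstCaseRisk_augmentedPlugin {c b : ℝ} {k m n : ℕ} (hc : c ∈ Set.Icc (2 / 3 : ℝ) (5 / 4))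
    (hk : 2 ≤ k) (hkm : k ≤ m) (hn : 10 * (k : ℝ) * b ≤ n) (hb : 10 ≤ b) :
    ENNReal.ofReal (1 / 10000000 * pluginRate k m n b) ≤
      worstCaseRisk (augmentedPlugin c k m n) m n b := by
  have hk' : (2 : ℝ) ≤ k := by exact_mod_cast hk
  have hm : 0 < m := by omega
  have hm' : (0 : ℝ) < m := by exact_mod_cast hm
  have hn' : (0 : ℝ) < n := by nlinarith
  have hn0 : 0 < n := by exact_mod_cast hn'
  have hcp : 0 < c := by linarith [hc.1]
  refine le_worstCaseRisk ?_
  obtain ⟨PQ₁, hmem₁, h₁⟩ := exists_risk_ge_log_sq_div_sample hk hm hn hb hc.1 hc.2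
  obtain ⟨PQ₂, hmem₂, h₂⟩ := exists_risk_ge_ratio_div_sample hk hm hn hb hcp hc.2
  obtain ⟨PQ₃, hmem₃, h₃⟩ := exists_risk_ge_alphabet_div_sample (b := b) hk hkm hn0 hcp
    (by linarith)
  have hA : 0 ≤ k * b / n := by positivity
  have hB : 0 ≤ (k : ℝ) / m := by positivity
  obtain ⟨PQ₄, hmem₄, h₄⟩ : ∃ PQ ∈ boundedRatioPairs k b,
      1 / 2000000 * ((k * b / n + k / m) ^ 2) ≤
        quadraticRisk (augmentedPlugin c k m n) m n PQ.1 PQ.2 := by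
    -- The two biases have opposite signs. If `k/m` is negligible, the pair with negative bias
    -- works; otherwise `(k/m)²` already dominates the squared sum, up to a constant.
    rcases le_total ((k : ℝ) / m) (1 / 100 * (k * b / n)) with h | h
    · obtain ⟨PQ, hmem, h'⟩ :=
        exists_risk_ge_ratio_alphabet_div_sample hk hkm hn hb hc.1 hc.2 h
      refine ⟨PQ, hmem, le_trans ?_ h'⟩
      generalize k * b / (n : ℝ) = A at *
      generalize (k : ℝ) / m = B at *
      nlinarith
    · refine ⟨PQ₃, hmem₃, le_trans ?_ h₃⟩
      generalize k * b / (n : ℝ) = A at *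
      generalize (k : ℝ) / m = B at *
      nlinarith
  rw [pluginRate]
  generalize (k * b / (n : ℝ) + k / m) ^ 2 = R at *
  have hL : 0 ≤ Real.log b ^ 2 / m := by positivity
  have hF : 0 ≤ b / n := by positivity
  generalize Real.log b ^ 2 / (m : ℝ) = L at *
  generalize b / (n : ℝ) = F at *
  -- The pair belonging to the largest of the three parts is used.
  by_cases g1 : L ≤ R
  · by_cases g2 : F ≤ R
    · exact ⟨PQ₄, hmem₄, by linarith⟩
    · exact ⟨PQ₂, hmem₂, by linarith⟩
  · by_cases g2 : F ≤ L
    · exact ⟨PQ₁, hmem₁, by linarith⟩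
    · exact ⟨PQ₂, hmem₂, by linarith⟩

theorem theorem2 :
    -- upper bound, for every smoothing constant
    (∀ c₀ c₁ f₀ : ℝ, 0 < c₀ → c₀ ≤ c₁ → 1 < f₀ → ∃ C : ℝ, 0 < C ∧
      ∀ c ∈ Set.Icc c₀ c₁, ∀ (f : ℕ → ℝ) (k m n : ℕ),
        1 ≤ k → k ≤ m → 10 * (k : ℝ) * f k ≤ n → f₀ ≤ f k →
          worstCaseRisk (augmentedPlugin c k m n) m n (f k) ≤
            ENNReal.ofReal (C * pluginRate k m n (f k))) ∧
    -- lower bound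
    (∃ C' : ℝ, 0 < C' ∧
      ∀ c ∈ Set.Icc (2 / 3 : ℝ) (5 / 4), ∀ (f : ℕ → ℝ) (k m n : ℕ),
        2 ≤ k → k ≤ m → 10 * (k : ℝ) * f k ≤ n → 10 ≤ f k →
          ENNReal.ofReal (C' * pluginRate k m n (f k)) ≤
            worstCaseRisk (augmentedPlugin c k m n) m n (f k)) := by
  refine ⟨fun c₀ c₁ f₀ hc₀ hc₁ hf₀ => ?_, 1 / 10000000, by norm_num,
    fun c hc f k m n hk hkm hn hb => le_worstCaseRisk_augmentedPlugin hc hk hkm hn hb⟩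
  obtain ⟨C, hC, h⟩ := worstCaseRisk_augmentedPlugin_le hc₀ hc₁ hf₀
  exact ⟨C, hC, fun c hc f k m n => h c hc (f k) k m n⟩
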